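/- **Conventions.** For a topological group $G$ and $n\ge 1$, let $r_n(G)\in\{0,1,2,\dots,\infty\}$ be the number of equivalence classes of continuous irreducible complex linear representations of $G$ of dimension $n$. The group $G$ is *rigid* if $r_n(G)<\infty$ for all $n\ge 1$; its representation zeta function is then the Dirichlet series $\zeta(G,s)=\zeta_G(s)=\sum_{n\ge 1} r_n(G)\,n^{-s}$. Finite groups carry the discrete topology. Let $H$ be a topological group and let $Q$ be a finite group acting on a non-empty finite set $X$. The wreath product $H\wr_X Q=H^X\rtimes Q$ is formed with respect to the action $(qb)(x)=b(q^{-1}x)$ of $Q$ on $H^X$, with the group topology for which $H^X$ has the product topology and is an open subgroup. Let $\Pi_Q(X)$ be the set of those partitions of $X$ which are the partition into $S$-orbits for some subgroup $S$ of $Q$, ordered by $P\le P'$ if $P$ refines $P'$; let $\mu_X$ be the Möbius function of this finite ordered set, so that $\mu_X(P,P)=1$, $\mu_X(P,P'')=-\sum_{P\le P'<P''}\mu_X(P,P')$ if $P<P''$, and $\mu_X(P,P'')=0$ unless $P\le P''$. For $P=(P_1,\dots,P_j)\in\Pi_Q(X)$, let $Q_P=\{q\in Q : q(P_i)=P_i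 \text{ for all } i\}$. **Theorem 1.** The group $H\wr_X Q$ is rigid if and only if $H$ is rigid. Moreover, when this is the case, $$ \zeta(H\wr_X Q,s)=\sum_{P\in\Pi_Q(X)}[Q:Q_P]^{-1-s}\,\zeta_{Q_P}(s)\sum_{P'=(P'_1,\dots,P'_\ell)\ge P}\mu_X(P,P')\,\zeta_H(|P'_1|s)\cdots\zeta_H(|P'_\ell|s). $$ This holds as an identity of formal Dirichlet series. It also holds as an identity of complex numbers at every $s\in\mathbb C$ at which $\zeta_H(s)$ converges absolutely; these are exactly the $s\in\mathbb C$ at which $\zeta(H\wr_X Q,s)$ converges absolutely. -/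

import Mathlib

open scoped Pointwise

noncomputable section

/-! ### Irreducible representations, rigidity, representation zeta functions -/

/-- A continuous irreducible representation of `G` on `ℂⁿ`. On a finite dimensional space,
continuity of all the orbit maps `g ↦ ρ(g) v` is the same as continuity of `ρ : G → GL(n, ℂ)`.
Irreducible includes nonzero, so that there is none for `n = 0`. -/
structure ContIrrep (G : Type*) [Group G] [TopologicalSpace G] (n : ℕ) where
  /-- the underlying linear representation -/
  rep : Representation ℂ G (Fin n → ℂ)
  continuous_rep : ∀ v : Fin n → ℂ, Continuous fun g : G => rep g v
  irreducible : rep.IsIrreducible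

/-- Equivalence of representations: existence of an invertible intertwining map. -/
instance ContIrrep.setoid (G : Type*) [Group G] [TopologicalSpace G] (n : ℕ) :
    Setoid (ContIrrep G n) where
  r ρ σ := Nonempty (ρ.rep.Equiv σ.rep)
  iseqv :=
    { refl := fun ρ => ⟨Representation.Equiv.refl ρ.rep⟩
      symm := fun ⟨e⟩ => ⟨e.symm⟩
      trans := fun ⟨e⟩ ⟨f⟩ => ⟨e.trans f⟩ }

/-- The part of degree `n` of the dual of `G`: the set of equivalence classes of continuous
irreducible complex representations of dimension `n`. -/
def IrrDual (G : Type*) [Group G] [TopologicalSpace G] (n : ℕ) : Type _ :=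
  Quotient (ContIrrep.setoid G n)

/-- `r_n(G) ∈ {0, 1, 2, …, ∞}`, the number of elements of degree `n` in the dual of `G`. -/
def numIrreps (G : Type*) [Group G] [TopologicalSpace G] (n : ℕ) : ℕ∞ :=
  ENat.card (IrrDual G n)

/-- `G` is rigid if `r_n(G) < ∞` for all `n ≥ 1`. -/
def IsRigid (G : Type*) [Group G] [TopologicalSpace G] : Prop :=
  ∀ n : ℕ, 1 ≤ n → numIrreps G n < ⊤

/-- The representation zeta function of `G` as a formal Dirichlet series `∑_{n ≥ 1} r_n(G) n^{-s}`
(meaningful for rigid `G`). The formal Dirichlet series `∑_{n ≥ 1} a_n n^{-s}` is represented by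
the arithmetic function `n ↦ a_n`; products are Dirichlet convolutions. -/
def repZetaSeries (G : Type*) [Group G] [TopologicalSpace G] : ArithmeticFunction ℂ where
  toFun n := if n = 0 then 0 else ((numIrreps G n).toNat : ℂ)
  map_zero' := if_pos rfl

/-- The function `ζ_G(s) = ∑_{n ≥ 1} r_n(G) n^{-s}`, at those `s` where the series converges
absolutely. -/
def repZeta (G : Type*) [Group G] [TopologicalSpace G] (s : ℂ) : ℂ :=
  LSeries (repZetaSeries G) s

/-- `ζ_G(s)` converges absolutely at `s`. -/
def RepZetaConverges (G : Type*) [Group G] [TopologicalSpace G] (s : ℂ) : Prop :=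
  LSeriesSummable (repZetaSeries G) s

/-! ### Operations on formal Dirichlet series -/

/-- For `f(s) = ∑_d a_d d^{-s}` and `k ≥ 1`, the formal Dirichlet series
`f(k s) = ∑_d a_d (d^k)^{-s}`. -/
def dirichletDilate (k : ℕ) (f : ArithmeticFunction ℂ) : ArithmeticFunction ℂ where
  toFun n := ∑ d ∈ n.divisors with d ^ k = n, f d
  map_zero' := by simp

/-- For `m ≥ 1`, the formal Dirichlet series `m^{-1-s}`, with the single coefficient `1 / m`
at `n = m`. -/
def dirichletPow (m : ℕ) : ArithmeticFunction ℂ where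
  toFun n := if n = 0 then 0 else if n = m then (m : ℂ)⁻¹ else 0
  map_zero' := if_pos rfl

/-! ### Permutational wreath products -/

/-- The permutational wreath product `H ≀_X Q = H^X ⋊ Q`, where `(q b)(x) = b (q⁻¹ x)`. -/
abbrev PermWreath (H Q X : Type*) [Group H] [Group Q] [MulAction Q X] : Type _ :=
  (X → H) ⋊[(mulAutArrow : Q →* MulAut (X → H))] Q

/-- The topology on `H ≀_X Q`: as a space it is `H^X × Q` with the product topology. For discrete
`Q` it is the group topology for which `H^X` has the product topology and is an open subgroup. -/
instance PermWreath.topologicalSpace (H Q X : Type*) [Group H] [Group Q] [MulAction Q X]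
    [TopologicalSpace H] [TopologicalSpace Q] : TopologicalSpace (PermWreath H Q X) :=
  TopologicalSpace.induced (fun g => (g.left, g.right)) instTopologicalSpaceProd

/-! ### The poset of orbit partitions -/

/-- `Π_Q(X)`: the partitions of `X` (as equivalence relations) that are the partition into
`S`-orbits for some subgroup `S` of `Q`. The order is the one of `Setoid X`: `P ≤ P'` if `P` is a
refinement of `P'`. -/
def OrbitPartition (Q X : Type*) [Group Q] [MulAction Q X] : Type _ :=
  {P : Setoid X // ∃ S : Subgroup Q, P = MulAction.orbitRel S X}

namespace OrbitPartition

variable {Q X : Type*} [Group Q] [MulAction Q X]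

instance : PartialOrder (OrbitPartition Q X) :=
  inferInstanceAs (PartialOrder {P : Setoid X // ∃ S : Subgroup Q, P = MulAction.orbitRel S X})

instance [Finite X] : Finite (OrbitPartition Q X) :=
  Finite.of_injective (fun P : OrbitPartition Q X => fun x y : X => P.1 x y) fun _ _ h =>
    Subtype.ext (Setoid.ext fun x y => iff_of_eq (congrFun (congrFun h x) y))

instance [Finite X] : Fintype (OrbitPartition Q X) := Fintype.ofFinite _

instance [Finite X] : DecidableEq (OrbitPartition Q X) := Classical.decEq _

instance [Finite X] : DecidableLE (OrbitPartition Q X) := Classical.decRel _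

instance [Finite X] : DecidableLT (OrbitPartition Q X) := Classical.decRel _

instance [Finite X] : LocallyFiniteOrder (OrbitPartition Q X) := Fintype.toLocallyFiniteOrder

/-- The Möbius function `μ_X` of `Π_Q(X)`. -/
def mobius [Finite X] (P P' : OrbitPartition Q X) : ℤ :=
  IncidenceAlgebra.mu ℤ P P'

/-- The finite set of blocks of a partition. -/
def blocks [Finite X] (P : OrbitPartition Q X) : Finset (Set X) :=
  (Set.toFinite P.1.classes).toFinset

/-- The stability subgroup `Q_P` of a partition `P`: the `q ∈ Q` with `q B = B` for every
block `B` of `P`. -/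
def stab (P : OrbitPartition Q X) : Subgroup Q :=
  ⨅ B ∈ P.1.classes, MulAction.stabilizer Q B

end OrbitPartition

end

/-! The proof is Clifford theory for the normal subgroup `H^X`. An irreducible representation of the
wreath product, restricted to `H^X`, involves outer tensor products of representations `W (φ x)` for
functions `φ` from `X` to the dual of `H`, and the functions that occur form one `Q`-orbit. The
tensor product attached to `φ` extends to its stabilizer by permuting factors, so the irreducible
representations over `φ` correspond to those of the isotropy group `fixer Q φ`. If the latter has
degree `m`, the former has degree `[Q : fixer Q φ] * (∏ x, d (φ x)) * m`. Weighting each `φ` by the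
inverse of its orbit length gives `ζ(H ≀ Q, s) = ∑_φ [Q : Q_φ]^(-1-s) ζ_{Q_φ}(s) ∏_x d(φ x)^(-s)`.

The group `Q_φ` is the stability group of its own orbit partition `ofFun Q φ` (`stab_ofFun`), so the
sum can be grouped by partitions. The functions with `P ≤ ofFun Q φ` are exactly those constant on
the blocks of `P` (`le_ofFun_iff`), and they contribute `∏_i ζ_H(|P_i| s)` (`prod_blocks_dilate`).
Möbius inversion isolates those with `P = ofFun Q φ` (`sum_mobius`).

The correspondence is obtained from idempotents rather than from decompositions into tensor
products. By the density theorem, `ℂ[H]` maps onto the product of the matrix algebras of finitely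
many inequivalent irreducible representations. Rank one idempotents `a i` are lifted, and `e_φ = ⨂ a
(φ x)` acts on any representation `V` of the wreath product. Compressing group elements by `e_φ`
leaves, up to scalars, only the elements of `Q_φ`, so `e_φ V` is a representation of `Q_φ`. If it is
nonzero, it is irreducible and determines `V` (`corner_isIrreducible`, `IsType.nonempty_equiv`).
Every irreducible representation of `Q_φ` arises in this way, inside a tensor power tensored with
the regular representation of `Q` (`exists_corner_equiv`). Only representations of `H` of degree at
most `n` matter for the coefficient of index `n`, so finite families suffice.

For the converse statements about rigidity and convergence, an irreducible representation of `H` is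
placed at one point of `X` and the trivial one elsewhere. This bounds `r_n(H)` by a finite
combination of the `r_{kn}(H ≀ Q)` with `1 ≤ k ≤ |Q|` (`card_le_sum`). -/

noncomputable section

/-! ### Generalities on finite dimensional representations -/

namespace Representation

open Module

variable {G : Type*} [Group G] {V W : Type*} [AddCommGroup V] [Module ℂ V]
  [AddCommGroup W] [Module ℂ W]

/-- Continuity of all matrix coefficients. -/
def MatrixContinuous [TopologicalSpace G] (ρ : Representation ℂ G V) : Prop :=
  ∀ (v : V) (l : Dual ℂ V), Continuous fun g => l (ρ g v)

theorem MatrixContinuous.sub [TopologicalSpace G] {ρ : Representation ℂ G V}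
    (h : ρ.MatrixContinuous) (p : Subrepresentation ρ) : p.toRepresentation.MatrixContinuous := by
  intro v l
  obtain ⟨l', rfl⟩ := LinearMap.exists_extend l
  exact h v l'

theorem MatrixContinuous.of_equiv [TopologicalSpace G] {ρ : Representation ℂ G V}
    {σ : Representation ℂ G W} (h : ρ.MatrixContinuous) (e : ρ.Equiv σ) :
    σ.MatrixContinuous := by
  intro w l
  refine (h (e.symm w) (l ∘ₗ e.toLinearMap)).congr fun g => ?_
  have := IntertwiningMap.isIntertwining _ _ e.toIntertwiningMap g (e.symm w)
  simp only [Equiv.coe_toIntertwiningMap] at this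
  simp [this]

theorem matrixContinuous_of_discrete [TopologicalSpace G] [DiscreteTopology G]
    (ρ : Representation ℂ G V) : ρ.MatrixContinuous :=
  fun _ _ => continuous_of_discreteTopology

/-- Irreducibility in terms of stable subspaces. -/
theorem isIrreducible_iff {ρ : Representation ℂ G V} :
    ρ.IsIrreducible ↔ Nontrivial V ∧
      ∀ p : Submodule ℂ V, (∀ g, ∀ v ∈ p, ρ g v ∈ p) → p = ⊥ ∨ p = ⊤ := by
  constructor
  · intro h
    refine ⟨?_, fun p hp => ?_⟩
    · by_contra hV
      rw [not_nontrivial_iff_subsingleton] at hV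
      have : (⊥ : Subrepresentation ρ) = ⊤ :=
        Subrepresentation.toSubmodule_injective (Subsingleton.elim _ _)
      exact bot_ne_top this
    · rcases h.eq_bot_or_eq_top (⟨p, fun g v hv => hp g v hv⟩ : Subrepresentation ρ) with h | h
      · exact Or.inl (congrArg Subrepresentation.toSubmodule h)
      · exact Or.inr (congrArg Subrepresentation.toSubmodule h)
  · rintro ⟨h0, h⟩
    have : Nontrivial (Subrepresentation ρ) := by
      refine ⟨⊥, ⊤, fun h' => ?_⟩
      exact bot_ne_top (congrArg Subrepresentation.toSubmodule h' : (⊥ : Submodule ℂ V) = ⊤)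
    refine ⟨fun p => ?_⟩
    rcases h p.toSubmodule (fun g v hv => p.apply_mem_toSubmodule g hv) with h | h
    · exact Or.inl (Subrepresentation.toSubmodule_injective h)
    · exact Or.inr (Subrepresentation.toSubmodule_injective h)

theorem IsIrreducible.nontrivial {ρ : Representation ℂ G V} (h : ρ.IsIrreducible) :
    Nontrivial V := (isIrreducible_iff.1 h).1

theorem IsIrreducible.eq_top {ρ : Representation ℂ G V} (h : ρ.IsIrreducible)
    {p : Submodule ℂ V} (hp : ∀ g, ∀ v ∈ p, ρ g v ∈ p) (h0 : p ≠ ⊥) : p = ⊤ :=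
  ((isIrreducible_iff.1 h).2 p hp).resolve_left h0

theorem IsIrreducible.of_equiv {ρ : Representation ℂ G V} {σ : Representation ℂ G W}
    (h : ρ.IsIrreducible) (e : ρ.Equiv σ) : σ.IsIrreducible := by
  rw [isIrreducible_iff] at h ⊢
  obtain ⟨h0, h⟩ := h
  refine ⟨e.toLinearEquiv.symm.toEquiv.nontrivial, fun p hp => ?_⟩
  have key : ∀ g v, e (ρ g v) = σ g (e v) := fun g v =>
    IntertwiningMap.isIntertwining _ _ e.toIntertwiningMap g v
  rcases h (p.comap e.toLinearEquiv.toLinearMap) (fun g v hv => by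
    simp only [Submodule.mem_comap] at hv ⊢
    exact (key g v).symm ▸ hp g _ hv) with h | h
  · left
    rw [Submodule.comap_equiv_eq_map_symm] at h
    exact Submodule.map_injective_of_injective e.toLinearEquiv.symm.injective
      (by simpa using h)
  · right
    rw [eq_top_iff]
    intro w _
    have : e.symm w ∈ p.comap e.toLinearEquiv.toLinearMap := h ▸ Submodule.mem_top
    have h2 : e (e.symm w) ∈ p := this
    simpa using h2

/-- A nonzero finite dimensional stable subspace contains an irreducible subrepresentation. -/
theorem exists_irreducible_le [FiniteDimensional ℂ V] (ρ : Representation ℂ G V)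
    (p : Submodule ℂ V) (hp : ∀ g, ∀ v ∈ p, ρ g v ∈ p) (h0 : p ≠ ⊥) :
    ∃ q : Subrepresentation ρ, q.toSubmodule ≤ p ∧ q.toRepresentation.IsIrreducible := by
  obtain ⟨q, ⟨hqp, hq, hq0⟩, hmin⟩ := (wellFounded_lt (α := Submodule ℂ V)).has_min
    {q | q ≤ p ∧ (∀ g, ∀ v ∈ q, ρ g v ∈ q) ∧ q ≠ ⊥} ⟨p, le_rfl, hp, h0⟩
  refine ⟨⟨q, fun g v hv => hq g v hv⟩, hqp, isIrreducible_iff.2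
    ⟨Submodule.nontrivial_iff_ne_bot.2 hq0, fun r hr => ?_⟩⟩
  by_contra! hc
  refine hmin (r.map q.subtype) ⟨(Submodule.map_subtype_le q r).trans hqp, ?_, ?_⟩ ?_
  · rintro g _ ⟨v, hv, rfl⟩
    exact ⟨_, hr g v hv, rfl⟩
  · intro h
    exact hc.1 (Submodule.map_injective_of_injective q.injective_subtype (by simpa using h))
  · refine lt_of_le_of_ne (Submodule.map_subtype_le q r) fun h => hc.2 ?_
    rw [eq_top_iff]
    intro v _
    have : (v : V) ∈ r.map q.subtype := h.symm.le v.2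
    obtain ⟨w, hw, hwv⟩ := this
    exact (Subtype.ext hwv : w = v) ▸ hw

theorem IntertwiningMap.map_asAlgebraHom {ρ : Representation ℂ G V} {σ : Representation ℂ G W}
    (f : IntertwiningMap ρ σ) (r : MonoidAlgebra ℂ G) (v : V) :
    f (ρ.asAlgebraHom r v) = σ.asAlgebraHom r (f v) := by
  induction r using MonoidAlgebra.induction_linear with
  | zero => simp
  | add x y hx hy => simp [hx, hy]
  | single g a => simp [asAlgebraHom_single, IntertwiningMap.isIntertwining]

end Representation

namespace ContIrrep

open Representation Module

variable {G : Type*} [Group G] [TopologicalSpace G] {n : ℕ}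

theorem matrixContinuous (c : ContIrrep G n) : c.rep.MatrixContinuous :=
  fun v l => (LinearMap.continuous_of_finiteDimensional l).comp (c.continuous_rep v)

/-- Every continuous irreducible representation of dimension `n` is equivalent to one on `ℂⁿ`. -/
theorem exists_equiv {V : Type*} [AddCommGroup V] [Module ℂ V] [FiniteDimensional ℂ V]
    (ρ : Representation ℂ G V) (h : ρ.IsIrreducible) (hc : ρ.MatrixContinuous)
    (hn : finrank ℂ V = n) : ∃ c : ContIrrep G n, Nonempty (ρ.Equiv c.rep) := by
  let e : V ≃ₗ[ℂ] (Fin n → ℂ) := (finBasisOfFinrankEq ℂ V hn).equivFun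
  let σ : Representation ℂ G (Fin n → ℂ) := ((e.conjAlgEquiv ℂ : End ℂ V ≃ₐ[ℂ] _) : End ℂ V →* _).comp ρ
  have hσ : ∀ g w, σ g w = e (ρ g (e.symm w)) := fun g w => rfl
  let E : ρ.Equiv σ := Representation.Equiv.mk e fun g => by
    ext v i; simp [hσ]
  refine ⟨⟨σ, fun v => ?_, h.of_equiv E⟩, ⟨E⟩⟩
  exact continuous_pi fun i => (hc.of_equiv E) v (LinearMap.proj i)

theorem pos (c : ContIrrep G n) : 0 < n := by
  have := c.irreducible.nontrivial
  rcases Nat.eq_zero_or_pos n with rfl | h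
  · exact absurd this (not_nontrivial _)
  · exact h

end ContIrrep

/-! ### The density theorem for finitely many irreducible representations -/

namespace Representation

open Module

variable {H : Type*} [Group H] {ι : Type*} [Finite ι]
  {W : ι → Type*} [∀ i, AddCommGroup (W i)] [∀ i, Module ℂ (W i)] [∀ i, FiniteDimensional ℂ (W i)]

/-- The group algebra maps onto the product of the matrix algebras of finitely many pairwise
inequivalent finite dimensional irreducible representations. -/
theorem exists_asAlgebraHom_eq (ρ : ∀ i, Representation ℂ H (W i)) (hirr : ∀ i, (ρ i).IsIrreducible)
    (hne : ∀ i j, i ≠ j → IsEmpty ((ρ i).Equiv (ρ j))) (T : ∀ i, End ℂ (W i)) :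
    ∃ r : MonoidAlgebra ℂ H, ∀ i, (ρ i).asAlgebraHom r = T i := by
  classical
  have := Fintype.ofFinite ι
  let R := MonoidAlgebra ℂ H
  let M := ∀ i, (ρ i).asModule
  have hs : ∀ i, IsSimpleModule R (ρ i).asModule := fun i =>
    (irreducible_iff_isSimpleModule_asModule _).1 (hirr i)
  have hss : IsSemisimpleModule R M := inferInstance
  -- By Schur's lemma an `R`-endomorphism of the direct sum is a scalar on each summand,
  -- inequivalence killing the off-diagonal components. Hence every family `T` commutes with all of
  -- `End R M`.
  have key : ∀ (f : End R M) (m : M), ∀ i, ∃ c : ℂ, (∀ m : M, f m i = c • (m i : W i)) := by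
    intro f m i
    have h1 : ∀ j, j ≠ i → ∀ w : (ρ j).asModule, f (Pi.single j w) i = 0 := by
      intro j hj w
      let g : (ρ j).asModule →ₗ[R] (ρ i).asModule :=
        LinearMap.proj i ∘ₗ f ∘ₗ LinearMap.single R (fun i => (ρ i).asModule) j
      rcases LinearMap.bijective_or_eq_zero g with hb | hz
      · refine ((hne j i hj).false ?_).elim
        exact ((IntertwiningMap.equivLinearMapAsModule (ρ j) (ρ i)).symm g).ofBijective hb
      · exact LinearMap.congr_fun hz w
    let g : IntertwiningMap (ρ i) (ρ i) := (IntertwiningMap.equivLinearMapAsModule _ _).symm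
        (LinearMap.proj i ∘ₗ f ∘ₗ LinearMap.single R (fun i => (ρ i).asModule) i)
    have hi := hirr i
    obtain ⟨c, hc⟩ := IsIrreducible.algebraMap_intertwiningMap_bijective_of_isAlgClosed.2 g
    refine ⟨c, fun m => ?_⟩
    have h2 : f m i = f (Pi.single i (m i)) i := by
      conv_lhs => rw [← Finset.univ_sum_single m]
      rw [map_sum, Finset.sum_apply, Finset.sum_eq_single i]
      · intro j _ hj; exact h1 j hj _
      · simp
    rw [h2]
    have : g (m i) = c • (m i : W i) := by rw [← hc]; rfl
    exact this
  let F : End (End R M) M :=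
    { toFun := fun m i => T i (m i)
      map_add' := fun m m' => funext fun i => map_add (T i) (m i) (m' i)
      map_smul' := fun f m => funext fun i => by
        obtain ⟨c, hc⟩ := key f m i
        change T i (f m i) = f (fun j => T j (m j)) i
        exact (congrArg (T i) (hc m)).trans
          ((map_smul (T i) c (m i : W i)).trans (hc fun j => T j (m j)).symm) }
  let b := fun i => Module.finBasis ℂ (W i)
  -- Jacobson density gives agreement on a finite set only; bases of all the summands are enough.
  let s : Finset M := Finset.univ.image fun x : (Σ i, Fin (finrank ℂ (W i))) =>
    (Pi.single x.1 (b x.1 x.2) : ∀ i, W i)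
  obtain ⟨r, hr⟩ := jacobson_density F s
  refine ⟨r, fun i => (b i).ext fun j => ?_⟩
  have := congrFun (hr (Pi.single i (b i j) : ∀ i, W i)
    (Finset.mem_image.2 ⟨⟨i, j⟩, Finset.mem_univ _, rfl⟩)) i
  change T i ((Pi.single i (b i j) : ∀ i, W i) i) =
    (ρ i).asAlgebraHom r ((Pi.single i (b i j) : ∀ i, W i) i) at this
  rw [Pi.single_eq_same] at this
  exact this.symm

end Representation

end

noncomputable section

set_option linter.unusedSectionVars false

theorem Pi.mulSingle_induction_noncomm {X : Type*} [Fintype X] [DecidableEq X] {M : X → Type*}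
    [∀ x, Monoid (M x)] (p : (∀ x, M x) → Prop) (one : p 1)
    (mul : ∀ r s, p r → p s → p (r * s)) (single : ∀ x m, p (Pi.mulSingle x m)) (r : ∀ x, M x) :
    p r := by
  rw [← Finset.noncommProd_mulSingle r]
  exact Finset.noncommProd_induction _ _ _ p mul one fun x _ => single x _

/-! ### Primitive idempotents -/

/-- Representatives, modulo the kernel of `Φ`, of some of the matrix units of a product of matrix
algebras of sizes `d i`: the idempotents `a i = E₀₀`, and `p i j = E_{j0}`, `q i j = E_{0j}`. -/
structure PrimitiveSystem {R A : Type*} [Ring R] [Algebra ℂ R] [Ring A] [Algebra ℂ A]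
    (Φ : R →ₐ[ℂ] A) {ι : Type*} [Fintype ι] (d : ι → ℕ) where
  /-- the primitive idempotents -/
  a : ι → R
  /-- first column -/
  p : ∀ i, Fin (d i) → R
  /-- first row -/
  q : ∀ i, Fin (d i) → R
  ortho : ∀ i k, i ≠ k → ∀ b, Φ (a i * b * a k) = 0
  corner : ∀ i b, ∃ c : ℂ, Φ (a i * b * a i) = Φ (c • a i)
  idem : ∀ i, Φ (a i * a i) = Φ (a i)
  sum_pq : Φ (∑ i, ∑ j, p i j * q i j) = Φ 1
  q_mul_p : ∀ i j, Φ (q i j * p i j) = Φ (a i)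
  map_a_ne_zero : ∀ i, Φ (a i) ≠ 0

section Family

open Module Representation

variable {H : Type*} [Group H] [TopologicalSpace H] {ι : Type*} {d : ι → ℕ}

/-- The action of the group algebra on all members of a family of representations. -/
def familyHom (W : ∀ i, ContIrrep H (d i)) :
    MonoidAlgebra ℂ H →ₐ[ℂ] (∀ i, End ℂ (Fin (d i) → ℂ)) :=
  AlgHom.pi fun i => (W i).rep.asAlgebraHom

/-- The members of a family of irreducible representations are pairwise inequivalent. -/
def PairwiseInequivalent (W : ∀ i, ContIrrep H (d i)) : Prop :=
  ∀ i j, i ≠ j → IsEmpty ((W i).rep.Equiv (W j).rep)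

theorem PairwiseInequivalent.surjective_familyHom [Finite ι] {W : ∀ i, ContIrrep H (d i)}
    (hW : PairwiseInequivalent W) : Function.Surjective (familyHom W) := by
  intro T
  obtain ⟨r, hr⟩ := exists_asAlgebraHom_eq (fun i => (W i).rep) (fun i => (W i).irreducible) hW T
  exact ⟨r, funext hr⟩

/-- The matrix units of each factor lift through the surjection `familyHom W`; the required
identities are their multiplication rules. -/
theorem PairwiseInequivalent.nonempty_primitiveSystem [Fintype ι] {W : ∀ i, ContIrrep H (d i)}
    (hW : PairwiseInequivalent W) : Nonempty (PrimitiveSystem (familyHom W) d) := by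
  classical
  let z : ∀ i, Fin (d i) := fun i => ⟨0, (W i).pos⟩
  let E : ∀ i, Fin (d i) → Fin (d i) → End ℂ (Fin (d i) → ℂ) := fun i j k =>
    Matrix.toLinAlgEquiv' (Matrix.single j k (1 : ℂ))
  have hEE : ∀ i j k l, E i j k * E i k l = E i j l := fun i j k l => by
    simp only [E, ← map_mul, Matrix.single_mul_single_same, mul_one]
  have hETE : ∀ i (T : End ℂ (Fin (d i) → ℂ)), ∃ c : ℂ,
      E i (z i) (z i) * T * E i (z i) (z i) = c • E i (z i) (z i) := fun i T => by
    obtain ⟨M, rfl⟩ := Matrix.toLinAlgEquiv'.surjective T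
    refine ⟨M (z i) (z i), ?_⟩
    simp only [E, ← map_mul, ← map_smul, Matrix.single_mul_mul_single, Matrix.smul_single]
    simp
  have hsum : ∀ i, ∑ j, E i j j = 1 := fun i => by
    simp only [E, ← map_sum, Matrix.sum_single_one, map_one]
  have hne : ∀ i, E i (z i) (z i) ≠ 0 := fun i h => by
    have h := (map_eq_zero_iff _ (Matrix.toLinAlgEquiv' (R := ℂ) (n := Fin (d i))).injective).1 h
    have := congrFun (congrFun h (z i)) (z i)
    simp at this
  have hsurj := hW.surjective_familyHom
  let s := Function.surjInv hsurj
  have hs : ∀ T, familyHom W (s T) = T := Function.surjInv_eq hsurj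
  let F : ∀ i, Fin (d i) → Fin (d i) → ∀ i, End ℂ (Fin (d i) → ℂ) := fun i j k =>
    Pi.single i (E i j k)
  refine ⟨⟨fun i => s (F i (z i) (z i)), fun i j => s (F i j (z i)), fun i j => s (F i (z i) j),
    ?_, ?_, ?_, ?_, ?_, ?_⟩⟩
  · intro i k hik b
    simp only [map_mul, hs, F]
    rw [← Pi.single_mul_left, ← Pi.single_mul_left, Pi.single_eq_of_ne hik,
      mul_zero, Pi.single_zero]
  · intro i b
    obtain ⟨c, hc⟩ := hETE i (familyHom W b i)
    refine ⟨c, ?_⟩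
    simp only [map_mul, map_smul, hs, F]
    rw [← Pi.single_mul_left, ← Pi.single_mul, hc, Pi.single_smul]
  · intro i
    simp only [map_mul, hs, F, ← Pi.single_mul, hEE]
  · simp only [map_sum, map_mul, hs, F, ← Pi.single_mul, hEE, map_one]
    ext1 k
    simp only [Finset.sum_apply]
    rw [Finset.sum_eq_single k]
    · simp [hsum]
    · intro i _ hi
      exact Finset.sum_eq_zero fun j _ => Pi.single_eq_of_ne hi.symm _
    · simp
  · intro i j
    simp only [map_mul, hs, F, ← Pi.single_mul, hEE]
  · intro i h
    rw [hs] at h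
    exact hne i (by simpa [F] using congrFun h i)

end Family

/-! ### The action of `∏ ℂ[H]` on a representation of the wreath product -/

namespace PermWreath

open Module Representation SemidirectProduct

variable {H Q X : Type*} [Group H] [Group Q] [MulAction Q X] [Fintype X] [dX : DecidableEq X]
  {V : Type*} [AddCommGroup V] [Module ℂ V] {V' : Type*} [AddCommGroup V'] [Module ℂ V']

/-- The restriction to the `x`-th factor of `H^X`. -/
def coordRep (ρ : Representation ℂ (PermWreath H Q X) V) (x : X) : Representation ℂ H V :=
  ρ.comp (inl.comp (MonoidHom.mulSingle (fun _ : X => H) x))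

/-- The action of the group algebra of the `x`-th factor of `H^X`. -/
def coord (ρ : Representation ℂ (PermWreath H Q X) V) (x : X) :
    MonoidAlgebra ℂ H →ₐ[ℂ] End ℂ V :=
  (coordRep ρ x).asAlgebraHom

theorem coord_single (ρ : Representation ℂ (PermWreath H Q X) V) (x : X) (h : H) (c : ℂ) :
    coord ρ x (MonoidAlgebra.single h c) = c • ρ (inl (Pi.mulSingle x h)) :=
  asAlgebraHom_single _ _ _

theorem commute_coord (ρ : Representation ℂ (PermWreath H Q X) V) :
    Pairwise fun x y => ∀ r s, Commute
      ((coord ρ x : MonoidAlgebra ℂ H →* End ℂ V) r) ((coord ρ y : MonoidAlgebra ℂ H →* End ℂ V) s) := by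
  intro x y hxy r s
  change Commute (coord ρ x r) (coord ρ y s)
  induction r using MonoidAlgebra.induction_linear with
  | zero => simp
  | add r r' hr hr' => rw [map_add]; exact hr.add_left hr'
  | single h c =>
    induction s using MonoidAlgebra.induction_linear with
    | zero => simp
    | add s s' hs hs' => rw [map_add]; exact hs.add_right hs'
    | single h' c' =>
      rw [coord_single, coord_single]
      refine Commute.smul_left (Commute.smul_right ?_ _) _
      exact ((Pi.mulSingle_commute hxy h h').map inl).map ρ

/-- The action of `⨂ ℂ[H]`, as a multiplicative map on `∏ ℂ[H]`. -/
def theta (ρ : Representation ℂ (PermWreath H Q X) V) : (X → MonoidAlgebra ℂ H) →* End ℂ V :=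
  MonoidHom.noncommPiCoprod (fun x => (coord ρ x : MonoidAlgebra ℂ H →* End ℂ V)) (commute_coord ρ)

variable (ρ : Representation ℂ (PermWreath H Q X) V)

theorem theta_mulSingle (x : X) (r : MonoidAlgebra ℂ H) :
    theta ρ (Pi.mulSingle x r) = coord ρ x r :=
  MonoidHom.noncommPiCoprod_mulSingle _ _ _

theorem theta_update (m : X → MonoidAlgebra ℂ H) (x : X) (r : MonoidAlgebra ℂ H) :
    theta ρ (Function.update m x r) = coord ρ x r * theta ρ (Function.update m x 1) := by
  rw [← theta_mulSingle, ← map_mul]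
  congr 1
  ext1 y
  rcases eq_or_ne y x with rfl | h
  · simp
  · simp [h]

/-- `theta` as a multilinear map. -/
def thetaMultilinear : MultilinearMap ℂ (fun _ : X => MonoidAlgebra ℂ H) (End ℂ V) where
  toFun := theta ρ
  map_update_add' m x r s := by
    rename_i h
    obtain rfl : h = dX := Subsingleton.elim _ _
    rw [theta_update, map_add, add_mul, ← theta_update, ← theta_update]
  map_update_smul' m x c r := by
    rename_i h
    obtain rfl : h = dX := Subsingleton.elim _ _
    rw [theta_update, map_smul, smul_mul_assoc, ← theta_update]

theorem thetaMultilinear_apply (r : X → MonoidAlgebra ℂ H) :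
    thetaMultilinear ρ r = theta ρ r := rfl

/-- This absorbs `ρ (inl b)` into `theta`, so that products with tensor idempotents are computed
coordinate by coordinate in `ℂ[H]`. -/
theorem theta_of (b : X → H) :
    theta ρ (fun x => MonoidAlgebra.of ℂ H (b x)) = ρ (inl b) := by
  have : (theta ρ).comp (MonoidHom.piMap fun _ : X => MonoidAlgebra.of ℂ H) =
      (ρ : _ →* End ℂ V).comp (inl : (X → H) →* PermWreath H Q X) := by
    refine MonoidHom.pi_ext fun x h => ?_
    have : MonoidHom.piMap (fun _ : X => MonoidAlgebra.of ℂ H) (Pi.mulSingle x h) =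
        Pi.mulSingle x (MonoidAlgebra.of ℂ H h) := by
      ext1 y
      rcases eq_or_ne y x with rfl | hy
      · simp
      · simp [hy, MonoidAlgebra.one_def]
    rw [MonoidHom.comp_apply, this, theta_mulSingle, MonoidAlgebra.of_apply, coord_single,
      one_smul]
    rfl
  exact DFunLike.congr_fun this b

theorem inr_mul_inl_mulSingle (q : Q) (x : X) (h : H) :
    (inr q * inl (Pi.mulSingle x h) : PermWreath H Q X) =
      inl (Pi.mulSingle (q • x) h) * inr q := by
  have := inl_aut (φ := (mulAutArrow : Q →* MulAut (X → H))) q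
    (Pi.mulSingle (M := fun _ : X => H) x h)
  rw [map_inv, eq_mul_inv_iff_mul_eq] at this
  rw [← this]
  congr 2
  ext1 y
  simp only [mulAutArrow_apply_apply]
  change Pi.mulSingle (M := fun _ : X => H) x h (q⁻¹ • y) = _
  simp only [Pi.mulSingle_apply, inv_smul_eq_iff]

theorem inr_mul_coord (q : Q) (x : X) (r : MonoidAlgebra ℂ H) :
    ρ (inr q) * coord ρ x r = coord ρ (q • x) r * ρ (inr q) := by
  induction r using MonoidAlgebra.induction_linear with
  | zero => simp
  | add r r' hr hr' => simp only [map_add, mul_add, add_mul, hr, hr']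
  | single h c =>
    rw [coord_single, coord_single, mul_smul_comm, smul_mul_assoc, ← map_mul, ← map_mul,
      inr_mul_inl_mulSingle]

theorem inr_mul_theta (q : Q) (r : X → MonoidAlgebra ℂ H) :
    ρ (inr q) * theta ρ r = theta ρ (fun x => r (q⁻¹ • x)) * ρ (inr q) := by
  induction r using Pi.mulSingle_induction_noncomm with
  | one => 
    have : (fun x : X => (1 : X → MonoidAlgebra ℂ H) (q⁻¹ • x)) = 1 := rfl
    rw [this, map_one, mul_one, one_mul]
  | mul r s hr hs =>
    have : (fun x : X => (r * s) (q⁻¹ • x)) = (fun x => r (q⁻¹ • x)) * fun x => s (q⁻¹ • x) := rfl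
    rw [this, map_mul, map_mul, ← mul_assoc, hr, mul_assoc, hs, mul_assoc]
  | single x m =>
    have : (fun y : X => Pi.mulSingle (M := fun _ => MonoidAlgebra ℂ H) x m (q⁻¹ • y)) =
        Pi.mulSingle (q • x) m := by
      ext1 y
      simp only [Pi.mulSingle_apply, inv_smul_eq_iff]
    rw [this, theta_mulSingle, theta_mulSingle, inr_mul_coord]

variable {ρ}

theorem map_coord {σ : Representation ℂ (PermWreath H Q X) V'} (f : IntertwiningMap ρ σ) (x : X)
    (r : MonoidAlgebra ℂ H) (v : V) : f (coord ρ x r v) = coord σ x r (f v) := by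
  induction r using MonoidAlgebra.induction_linear with
  | zero => simp
  | add r s hr hs => simp [hr, hs]
  | single h c => simp [coord_single, IntertwiningMap.isIntertwining]

theorem map_theta {σ : Representation ℂ (PermWreath H Q X) V'} (f : IntertwiningMap ρ σ)
    (r : X → MonoidAlgebra ℂ H) : ∀ v, f (theta ρ r v) = theta σ r (f v) := by
  induction r using Pi.mulSingle_induction_noncomm with
  | one => simp
  | mul r s hr hs => intro v; simp [hr, hs]
  | single x m => intro v; rw [theta_mulSingle, theta_mulSingle, map_coord]

/-- All the coordinate actions of `ℂ[H]` factor through `Φ`. -/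
def IsType {A : Type*} [Ring A] [Algebra ℂ A] (Φ : MonoidAlgebra ℂ H →ₐ[ℂ] A)
    (ρ : Representation ℂ (PermWreath H Q X) V) : Prop :=
  ∀ x r, Φ r = 0 → coord ρ x r = 0

section IsType

variable {A : Type*} [Ring A] [Algebra ℂ A] {Φ : MonoidAlgebra ℂ H →ₐ[ℂ] A}

theorem IsType.of_injective {σ : Representation ℂ (PermWreath H Q X) V'} (hσ : IsType Φ σ)
    (f : IntertwiningMap ρ σ) (hf : Function.Injective f) : IsType Φ ρ := by
  intro x r hr
  ext v
  apply hf
  rw [map_coord, hσ x r hr]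
  simp

theorem IsType.prod {σ : Representation ℂ (PermWreath H Q X) V'} (hρ : IsType Φ ρ)
    (hσ : IsType Φ σ) : IsType Φ (ρ.prod σ) := by
  intro x r hr
  refine LinearMap.ext fun v => Prod.ext ?_ ?_
  · have := map_coord (IntertwiningMap.fst ℂ ρ σ) x r v
    rw [hρ x r hr] at this
    exact this
  · have := map_coord (IntertwiningMap.snd ℂ ρ σ) x r v
    rw [hσ x r hr] at this
    exact this

theorem IsType.coord_congr (hρ : IsType Φ ρ) (x : X) {r s : MonoidAlgebra ℂ H} (h : Φ r = Φ s) :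
    coord ρ x r = coord ρ x s := by
  rw [← sub_eq_zero, ← map_sub]
  exact hρ x _ (by rw [map_sub, h, sub_self])

theorem IsType.theta_congr (hρ : IsType Φ ρ) {r s : X → MonoidAlgebra ℂ H}
    (h : ∀ x, Φ (r x) = Φ (s x)) : theta ρ r = theta ρ s :=
  Finset.noncommProd_congr rfl (fun x _ => hρ.coord_congr x (h x))
    fun _ _ _ _ h => commute_coord ρ h _ _

theorem IsType.theta_eq_zero (hρ : IsType Φ ρ) {r : X → MonoidAlgebra ℂ H} (x : X)
    (h : Φ (r x) = 0) : theta ρ r = 0 := by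
  rw [← Function.update_eq_self x r, theta_update, hρ x _ h, zero_mul]

end IsType

end PermWreath

end

noncomputable section

set_option linter.unusedSectionVars false

/-! ### Corners -/

section Fixer

variable (Q : Type*) {X ι : Type*} [Group Q] [MulAction Q X]

/-- The isotropy group of a function on `X`. -/
def fixer (φ : X → ι) : Subgroup Q where
  carrier := {q | ∀ x, φ (q • x) = φ x}
  mul_mem' {a b} ha hb x := by rw [mul_smul, ha, hb]
  one_mem' x := by rw [one_smul]
  inv_mem' {a} ha x := by rw [← ha, smul_inv_smul]

variable {Q}

theorem mem_fixer {φ : X → ι} {q : Q} : q ∈ fixer Q φ ↔ ∀ x, φ (q • x) = φ x := Iff.rfl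

theorem mem_fixer_iff_comp_inv {φ : X → ι} {q : Q} :
    q ∈ fixer Q φ ↔ (fun x => φ (q⁻¹ • x)) = φ := by
  rw [← inv_mem_iff, mem_fixer, funext_iff]

theorem ncard_translates [Finite Q] (φ : X → ι) :
    {ψ : X → ι | ∃ q : Q, (fun x => φ (q⁻¹ • x)) = ψ}.ncard = (fixer Q φ).index := by
  let _ : MulAction Q (X → ι) := arrowAction
  have h : fixer Q φ = MulAction.stabilizer Q φ := by
    ext q
    exact mem_fixer_iff_comp_inv
  rw [h, MulAction.index_stabilizer]
  rfl

end Fixer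

namespace PermWreath

open Module Representation SemidirectProduct

variable {H Q X : Type*} [Group H] [Group Q] [MulAction Q X] [Fintype X] [dX : DecidableEq X]
  {V : Type*} [AddCommGroup V] [Module ℂ V] {V' : Type*} [AddCommGroup V'] [Module ℂ V']
  {A : Type*} [Ring A] [Algebra ℂ A] {Φ : MonoidAlgebra ℂ H →ₐ[ℂ] A}
  {ι : Type*} [Fintype ι] {d : ι → ℕ} (S : PrimitiveSystem Φ d)
  (ρ : Representation ℂ (PermWreath H Q X) V)

/-- The idempotent `⨂ a (φ x)`. -/
def idem (φ : X → ι) : End ℂ V := theta ρ fun x => S.a (φ x)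

variable {ρ}

theorem map_idem {σ : Representation ℂ (PermWreath H Q X) V'} (f : IntertwiningMap ρ σ)
    (φ : X → ι) (v : V) : f (idem S ρ φ v) = idem S σ φ (f v) :=
  map_theta f _ v

theorem idem_prod {σ : Representation ℂ (PermWreath H Q X) V'} (φ : X → ι) (v : V × V') :
    idem S (ρ.prod σ) φ v = (idem S ρ φ v.1, idem S σ φ v.2) :=
  Prod.ext (map_idem S (IntertwiningMap.fst ℂ ρ σ) φ v)
    (map_idem S (IntertwiningMap.snd ℂ ρ σ) φ v)

variable (ρ) in
theorem inr_mul_idem (q : Q) (φ : X → ι) :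
    ρ (inr q) * idem S ρ φ = idem S ρ (fun x => φ (q⁻¹ • x)) * ρ (inr q) :=
  inr_mul_theta ρ q _

variable (ρ) in
theorem commute_idem {q : Q} {φ : X → ι} (hq : q ∈ fixer Q φ) (v : V) :
    idem S ρ φ (ρ (inr q) v) = ρ (inr q) (idem S ρ φ v) := by
  have := inr_mul_idem S ρ q φ
  rw [mem_fixer_iff_comp_inv.1 hq] at this
  exact (LinearMap.congr_fun this v).symm

section IsType

theorem IsType.idem_mul_self (hρ : IsType Φ ρ) (φ : X → ι) :
    idem S ρ φ * idem S ρ φ = idem S ρ φ := by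
  rw [idem, ← map_mul]
  exact hρ.theta_congr fun x => S.idem _

theorem IsType.idem_apply_idem (hρ : IsType Φ ρ) (φ : X → ι) (v : V) :
    idem S ρ φ (idem S ρ φ v) = idem S ρ φ v :=
  LinearMap.congr_fun (hρ.idem_mul_self S φ) v

theorem IsType.idem_apply_of_mem (hρ : IsType Φ ρ) {φ : X → ι} {v : V}
    (hv : v ∈ LinearMap.range (idem S ρ φ)) : idem S ρ φ v = v := by
  obtain ⟨w, rfl⟩ := hv
  exact hρ.idem_apply_idem S φ w

/-- At a coordinate where `φ` and `ψ` differ, orthogonality of the primitive idempotents kills the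
factor. -/
theorem IsType.idem_mul_inl_mul_idem_of_ne (hρ : IsType Φ ρ) {φ ψ : X → ι} (h : φ ≠ ψ)
    (b : X → H) : idem S ρ φ * ρ (inl b) * idem S ρ ψ = 0 := by
  obtain ⟨x, hx⟩ := Function.ne_iff.1 h
  rw [idem, idem, ← theta_of, ← map_mul, ← map_mul]
  exact hρ.theta_eq_zero x (S.ortho _ _ hx _)

/-- Each coordinate contributes a scalar, since `a i` is primitive modulo the kernel of `Φ`;
multilinearity of `theta` collects the scalars into a product. -/
theorem IsType.exists_idem_mul_inl_mul_idem (hρ : IsType Φ ρ) (φ : X → ι) (b : X → H) :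
    ∃ c : ℂ, idem S ρ φ * ρ (inl b) * idem S ρ φ = c • idem S ρ φ := by
  choose c hc using fun x => S.corner (φ x) (MonoidAlgebra.of ℂ H (b x))
  refine ⟨∏ x, c x, ?_⟩
  rw [idem, ← theta_of, ← map_mul, ← map_mul, ← thetaMultilinear_apply,
    ← thetaMultilinear_apply, ← MultilinearMap.map_smul_univ]
  exact hρ.theta_congr hc

theorem IsType.idem_mul_rep_mul_idem_of_ne (hρ : IsType Φ ρ) {φ ψ : X → ι}
    (g : PermWreath H Q X) (h : φ ≠ fun x => ψ (g.right⁻¹ • x)) :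
    idem S ρ φ * ρ g * idem S ρ ψ = 0 := by
  rw [← inl_left_mul_inr_right g, map_mul, ← mul_assoc, mul_assoc, inr_mul_idem, ← mul_assoc,
    hρ.idem_mul_inl_mul_idem_of_ne S h, zero_mul]

/-- Moving the idempotent past `inr g.right` translates its function and leaves a computation in
`H^X`. For `φ = ψ` this says that the compression of the group by `idem S ρ φ` consists, up to
scalars, of the action of `fixer Q φ`, on which the Clifford correspondence rests. -/
theorem IsType.exists_idem_mul_rep_mul_idem (hρ : IsType Φ ρ) {φ ψ : X → ι}
    (g : PermWreath H Q X) (h : φ = fun x => ψ (g.right⁻¹ • x)) :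
    ∃ c : ℂ, idem S ρ φ * ρ g * idem S ρ ψ = c • (ρ (inr g.right) * idem S ρ ψ) := by
  subst h
  obtain ⟨c, hc⟩ := hρ.exists_idem_mul_inl_mul_idem S (fun x => ψ (g.right⁻¹ • x)) g.left
  refine ⟨c, ?_⟩
  have hg : ρ g = ρ (inl g.left) * ρ (inr g.right) := by
    rw [← map_mul, inl_left_mul_inr_right]
  rw [hg, ← mul_assoc, mul_assoc, inr_mul_idem, ← mul_assoc, hc, smul_mul_assoc]

/-- A subspace of the corner that is stable under the isotropy group is the corner of the
subrepresentation that it generates. -/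
theorem IsType.idem_rep_mem (hρ : IsType Φ ρ) {φ : X → ι} {M : Submodule ℂ V}
    (hM : M ≤ LinearMap.range (idem S ρ φ))
    (hs : ∀ q ∈ fixer Q φ, ∀ v ∈ M, ρ (inr q) v ∈ M) (g : PermWreath H Q X) {v : V} (hv : v ∈ M) :
    idem S ρ φ (ρ g v) ∈ M := by
  rw [← hρ.idem_apply_of_mem S (hM hv)]
  by_cases h : φ = fun x => φ (g.right⁻¹ • x)
  · obtain ⟨c, hc⟩ := hρ.exists_idem_mul_rep_mul_idem S g h
    have := LinearMap.congr_fun hc v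
    simp only [End.mul_apply, LinearMap.smul_apply] at this
    rw [this, hρ.idem_apply_of_mem S (hM hv)]
    exact M.smul_mem _ (hs _ (mem_fixer_iff_comp_inv.2 h.symm) v hv)
  · have := LinearMap.congr_fun (hρ.idem_mul_rep_mul_idem_of_ne S g h) v
    simp only [End.mul_apply, LinearMap.zero_apply] at this
    rw [this]
    exact M.zero_mem

end IsType

variable (ρ)

/-- The largest subrepresentation whose corner is contained in `M`. -/
def maxSub (φ : X → ι) (M : Submodule ℂ V) : Submodule ℂ V where
  carrier := {v | ∀ g, idem S ρ φ (ρ g v) ∈ M}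
  add_mem' ha hb g := by simpa using M.add_mem (ha g) (hb g)
  zero_mem' g := by simp
  smul_mem' c v hv g := by simpa using M.smul_mem c (hv g)

theorem maxSub_stable (φ : X → ι) (M : Submodule ℂ V) (g : PermWreath H Q X) (v : V)
    (hv : v ∈ maxSub S ρ φ M) : ρ g v ∈ maxSub S ρ φ M := fun g' => by
  have := hv (g' * g)
  rwa [map_mul] at this

/-- The corner of a representation cut out by `idem S ρ φ`, as a representation of the isotropy
group of `φ`. -/
def corner (φ : X → ι) : Representation ℂ (fixer Q φ) (LinearMap.range (idem S ρ φ)) where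
  toFun q := (ρ (inr (q : Q))).restrict (by
    rintro _ ⟨v, rfl⟩
    exact ⟨_, commute_idem S ρ q.2 v⟩)
  map_one' := by ext; simp
  map_mul' q q' := by ext; simp

variable {ρ}

/-- The vectors in question form the subrepresentation `maxSub S ρ φ ⊥`, which is proper because the
idempotent is nonzero. -/
theorem IsType.eq_bot_of_idem_eq_zero (hirr : ρ.IsIrreducible)
    {φ : X → ι} (h0 : idem S ρ φ ≠ 0) {v : V} (hv : ∀ g, idem S ρ φ (ρ g v) = 0) : v = 0 := by
  by_contra hv0
  have h1 : maxSub S ρ φ ⊥ = ⊤ := hirr.eq_top (maxSub_stable S ρ φ ⊥)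
    ((Submodule.ne_bot_iff _).2 ⟨v, fun g => by simp [hv g], hv0⟩)
  refine h0 (LinearMap.ext fun w => ?_)
  have : w ∈ maxSub S ρ φ ⊥ := h1 ▸ Submodule.mem_top
  simpa using this 1

/-- For a nonzero stable `M` in the corner, the largest subrepresentation with corner in `M`
contains `M`, hence is everything; so the whole corner lies in `M`. -/
theorem IsType.corner_isIrreducible (hρ : IsType Φ ρ) (hirr : ρ.IsIrreducible) {φ : X → ι}
    (h0 : idem S ρ φ ≠ 0) : (corner S ρ φ).IsIrreducible := by
  refine isIrreducible_iff.2 ⟨Submodule.nontrivial_iff_ne_bot.2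
    (by rwa [Ne, LinearMap.range_eq_bot]), fun M hM => ?_⟩
  rw [or_iff_not_imp_left]
  intro hM0
  obtain ⟨m, hm, hm0⟩ := (Submodule.ne_bot_iff _).1 hM0
  let M' := M.map (LinearMap.range (idem S ρ φ)).subtype
  have hM' : M' ≤ LinearMap.range (idem S ρ φ) := Submodule.map_subtype_le _ _
  have hs : ∀ q ∈ fixer Q φ, ∀ v ∈ M', ρ (inr q) v ∈ M' := by
    rintro q hq _ ⟨v, hv, rfl⟩
    exact ⟨_, hM ⟨q, hq⟩ v hv, rfl⟩
  have h1 : maxSub S ρ φ M' = ⊤ := hirr.eq_top (maxSub_stable S ρ φ M')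
    ((Submodule.ne_bot_iff _).2 ⟨m, fun g => hρ.idem_rep_mem S hM' hs g ⟨m, hm, rfl⟩,
      by simpa using hm0⟩)
  rw [eq_top_iff]
  rintro ⟨v, hv⟩ _
  have h2 : v ∈ maxSub S ρ φ M' := h1 ▸ Submodule.mem_top
  have h3 := h2 1
  rw [map_one, End.one_apply, hρ.idem_apply_of_mem S hv] at h3
  obtain ⟨w, hw, hwv⟩ := h3
  exact (Subtype.ext hwv : w = ⟨v, hv⟩) ▸ hw

/-- The equivalence of corners induced by an equivalence. -/
theorem nonempty_corner_equiv {σ : Representation ℂ (PermWreath H Q X) V'} (e : ρ.Equiv σ)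
    (φ : X → ι) : Nonempty ((corner S ρ φ).Equiv (corner S σ φ)) := by
  have he : ∀ v, e (idem S ρ φ v) = idem S σ φ (e v) := map_idem S e.toIntertwiningMap φ
  have hm : (LinearMap.range (idem S ρ φ)).map (e.toLinearEquiv : V →ₗ[ℂ] V') =
      LinearMap.range (idem S σ φ) := by
    ext w
    constructor
    · rintro ⟨_, ⟨v, rfl⟩, rfl⟩
      exact ⟨e v, (he v).symm⟩
    · rintro ⟨w, rfl⟩
      exact ⟨_, ⟨e.symm w, rfl⟩, (he _).trans (by simp)⟩
  refine ⟨Representation.Equiv.mk (e.toLinearEquiv.ofSubmodules _ _ hm) fun q => ?_⟩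
  refine LinearMap.ext fun v => Subtype.ext ?_
  exact IntertwiningMap.isIntertwining _ _ e.toIntertwiningMap (inr (q : Q)) (v : V)

theorem idem_ne_zero_of_equiv {σ : Representation ℂ (PermWreath H Q X) V'} (e : ρ.Equiv σ)
    {φ : X → ι} (h : idem S ρ φ ≠ 0) : idem S σ φ ≠ 0 := by
  intro h0
  refine h (LinearMap.ext fun v => e.toLinearEquiv.injective ?_)
  exact (map_idem S e.toIntertwiningMap φ v).trans (by simp [h0])

/-- An irreducible representation is determined by any of its nonzero corners. -/
theorem IsType.nonempty_equiv {σ : Representation ℂ (PermWreath H Q X) V'} (hρ : IsType Φ ρ)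
    (hσ : IsType Φ σ) (hρi : ρ.IsIrreducible) (hσi : σ.IsIrreducible) {φ : X → ι}
    (h0 : idem S ρ φ ≠ 0) (f : (corner S ρ φ).Equiv (corner S σ φ)) : Nonempty (ρ.Equiv σ) := by
  -- A Goursat argument: `M` is the graph of `f` in the corner of `V ⊕ V'`, and `N` below is the
  -- largest subrepresentation whose corner lies in this graph. Both projections of `N` are
  -- injective, because a vector with one component zero has all its translates killed by the
  -- idempotent. They are surjective because they are nonzero with irreducible target.
  let M : Submodule ℂ (V × V') := LinearMap.range
    (((LinearMap.range (idem S ρ φ)).subtype).prod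
      ((LinearMap.range (idem S σ φ)).subtype ∘ₗ f.toLinearMap))
  have memM : ∀ v, (((v : LinearMap.range (idem S ρ φ)) : V), ((f v : _) : V')) ∈ M :=
    fun v => ⟨v, rfl⟩
  have hτ := hρ.prod hσ
  have hM : M ≤ LinearMap.range (idem S (ρ.prod σ) φ) := by
    rintro _ ⟨v, rfl⟩
    refine ⟨((v : V), ((f v : _) : V')), ?_⟩
    rw [idem_prod]
    exact Prod.ext (hρ.idem_apply_of_mem S v.2) (hσ.idem_apply_of_mem S (f v).2)
  have hs : ∀ q ∈ fixer Q φ, ∀ v ∈ M, (ρ.prod σ) (inr q) v ∈ M := by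
    rintro q hq _ ⟨v, rfl⟩
    refine ⟨corner S ρ φ ⟨q, hq⟩ v, Prod.ext rfl ?_⟩
    exact congrArg Subtype.val
      (IntertwiningMap.isIntertwining _ _ f.toIntertwiningMap ⟨q, hq⟩ v)
  let N : Subrepresentation (ρ.prod σ) :=
    ⟨maxSub S (ρ.prod σ) φ M, fun g v hv => maxSub_stable S _ φ M g v hv⟩
  have hMN : ∀ v ∈ M, v ∈ maxSub S (ρ.prod σ) φ M := fun v hv g => hτ.idem_rep_mem S hM hs g hv
  have hN : ∀ v ∈ maxSub S (ρ.prod σ) φ M, ∀ g, ∃ m : LinearMap.range (idem S ρ φ),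
      (m : V) = idem S ρ φ (ρ g v.1) ∧ (f m : V') = idem S σ φ (σ g v.2) := by
    intro v hv g
    obtain ⟨m, hm⟩ := hv g
    rw [idem_prod] at hm
    exact ⟨m, congrArg Prod.fst hm, congrArg Prod.snd hm⟩
  have h0' : idem S σ φ ≠ 0 := by
    obtain ⟨v, hv⟩ := DFunLike.ne_iff.1 h0
    intro h
    have h1 : ((f ⟨idem S ρ φ v, v, rfl⟩ : LinearMap.range (idem S σ φ)) : V') = 0 :=
      (hσ.idem_apply_of_mem S (f ⟨idem S ρ φ v, v, rfl⟩).2).symm.trans (LinearMap.congr_fun h _)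
    have h2 : f ⟨idem S ρ φ v, v, rfl⟩ = f 0 := by
      rw [map_zero]; exact Subtype.ext h1
    exact hv (congrArg Subtype.val (f.toLinearEquiv.injective h2))
  let π₁ : IntertwiningMap N.toRepresentation ρ :=
    ⟨LinearMap.fst ℂ V V' ∘ₗ N.toSubmodule.subtype, fun g => rfl⟩
  let π₂ : IntertwiningMap N.toRepresentation σ :=
    ⟨LinearMap.snd ℂ V V' ∘ₗ N.toSubmodule.subtype, fun g => rfl⟩
  have inj₁ : Function.Injective π₁ := by
    refine (injective_iff_map_eq_zero π₁.toLinearMap).2 fun v hv => ?_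
    have hv : v.1.1 = 0 := hv
    refine Subtype.ext (Prod.ext hv ?_)
    refine eq_bot_of_idem_eq_zero S hσi h0' fun g => ?_
    obtain ⟨m, hm, hm'⟩ := hN v.1 v.2 g
    rw [hv, map_zero, map_zero] at hm
    rw [← hm', show m = 0 from Subtype.ext hm, map_zero]
    rfl
  have inj₂ : Function.Injective π₂ := by
    refine (injective_iff_map_eq_zero π₂.toLinearMap).2 fun v hv => ?_
    have hv : v.1.2 = 0 := hv
    refine Subtype.ext (Prod.ext ?_ hv)
    refine eq_bot_of_idem_eq_zero S hρi h0 fun g => ?_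
    obtain ⟨m, hm, hm'⟩ := hN v.1 v.2 g
    rw [hv, map_zero, map_zero] at hm'
    have : f m = f 0 := by rw [map_zero]; exact Subtype.ext hm'
    rw [← hm, f.toLinearEquiv.injective this]
    rfl
  obtain ⟨v, hv⟩ := DFunLike.ne_iff.1 h0
  let w : LinearMap.range (idem S ρ φ) := ⟨idem S ρ φ v, v, rfl⟩
  have hw : w ≠ 0 := fun h => hv (congrArg Subtype.val h)
  let n : N.toSubmodule := ⟨(w, f w), hMN _ (memM w)⟩
  have surj₁ : Function.Surjective π₁ := by
    have := hρi
    refine (IsIrreducible.surjective_or_eq_zero π₁).resolve_right fun h => hw ?_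
    exact Subtype.ext (DFunLike.congr_fun h n)
  have surj₂ : Function.Surjective π₂ := by
    have := hσi
    refine (IsIrreducible.surjective_or_eq_zero π₂).resolve_right fun h => hw ?_
    refine f.toLinearEquiv.injective ((Subtype.ext (DFunLike.congr_fun h n) : f w = 0).trans ?_)
    exact (map_zero f.toLinearEquiv).symm
  exact ⟨(π₁.ofBijective ⟨inj₁, surj₁⟩).symm.trans (π₂.ofBijective ⟨inj₂, surj₂⟩)⟩

/-! ### Dimension formula, and the orbit of functions below an irreducible representation -/

section Dimension

variable [FiniteDimensional ℂ V]

theorem IsType.trace_idem (hρ : IsType Φ ρ) (φ : X → ι) :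
    LinearMap.trace ℂ V (idem S ρ φ) = finrank ℂ (LinearMap.range (idem S ρ φ)) :=
  LinearMap.IsProj.trace
    (LinearMap.IsIdempotentElem.isProj_range _ (hρ.idem_mul_self S φ))

/-- Expand the identity as `⨂ (∑ p i j * q i j)` and take traces. Since `tr (p q) = tr (q p)`, each
term becomes the trace of the idempotent of `φ`, and there are `∏ x, d (φ x)` of them for each `φ`.
-/
theorem IsType.finrank_eq_sum (hρ : IsType Φ ρ) :
    finrank ℂ V =
      ∑ φ : X → ι, (∏ x, d (φ x)) * finrank ℂ (LinearMap.range (idem S ρ φ)) := by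
  have h1 : (1 : End ℂ V) = ∑ φ : X → ι, ∑ j : ∀ x, Fin (d (φ x)),
      theta ρ (fun x => S.p (φ x) (j x)) * theta ρ (fun x => S.q (φ x) (j x)) := by
    rw [← map_one (theta ρ)]
    change theta ρ (fun _ => 1) = _
    rw [← hρ.theta_congr (r := fun _ => ∑ i, ∑ j, S.p i j * S.q i j)
      (fun x => S.sum_pq), ← thetaMultilinear_apply, MultilinearMap.map_sum]
    refine Finset.sum_congr rfl fun φ _ => ?_
    rw [MultilinearMap.map_sum]
    refine Finset.sum_congr rfl fun j _ => ?_
    rw [thetaMultilinear_apply, ← map_mul]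
    rfl
  have h2 := congrArg (LinearMap.trace ℂ V) h1
  rw [LinearMap.trace_one, map_sum] at h2
  have h3 : ∀ φ : X → ι, LinearMap.trace ℂ V (∑ j : ∀ x, Fin (d (φ x)),
      theta ρ (fun x => S.p (φ x) (j x)) * theta ρ (fun x => S.q (φ x) (j x))) =
      ((∏ x, d (φ x)) * finrank ℂ (LinearMap.range (idem S ρ φ)) : ℕ) := by
    intro φ
    rw [map_sum]
    have : ∀ j : ∀ x, Fin (d (φ x)), LinearMap.trace ℂ V
        (theta ρ (fun x => S.p (φ x) (j x)) * theta ρ (fun x => S.q (φ x) (j x))) =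
        finrank ℂ (LinearMap.range (idem S ρ φ)) := by
      intro j
      rw [LinearMap.trace_mul_comm, ← map_mul, ← hρ.trace_idem S φ, idem]
      congr 1
      exact hρ.theta_congr fun x => S.q_mul_p _ _
    simp [this]
  rw [Finset.sum_congr rfl fun φ _ => h3 φ] at h2
  exact_mod_cast h2

theorem IsType.exists_idem_ne_zero (hρ : IsType Φ ρ) [Nontrivial V] :
    ∃ φ : X → ι, idem S ρ φ ≠ 0 := by
  by_contra! h
  have h1 := hρ.finrank_eq_sum S
  rw [Finset.sum_eq_zero] at h1
  · exact (finrank_pos (R := ℂ) (M := V)).ne' h1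
  · intro φ _
    rw [h φ, LinearMap.range_zero, finrank_bot, mul_zero]

theorem finrank_range_idem_translate (q : Q) (φ : X → ι) :
    finrank ℂ (LinearMap.range (idem S ρ fun x => φ (q⁻¹ • x))) =
      finrank ℂ (LinearMap.range (idem S ρ φ)) := by
  let e : V ≃ₗ[ℂ] V := LinearEquiv.ofLinearMap (ρ (inr q)) (ρ (inr q⁻¹))
    (by rw [← End.mul_eq_comp, ← map_mul, ← map_mul]; simp; rfl)
    (by rw [← End.mul_eq_comp, ← map_mul, ← map_mul]; simp; rfl)
  have h := inr_mul_idem S ρ q φ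
  have : LinearMap.range (idem S ρ fun x => φ (q⁻¹ • x)) =
      (LinearMap.range (idem S ρ φ)).map (e : V →ₗ[ℂ] V) := by
    rw [← LinearMap.range_comp]
    change _ = LinearMap.range (ρ (inr q) * idem S ρ φ)
    rw [h]
    exact (LinearMap.range_comp_of_range_eq_top _ e.range).symm
  rw [this]
  exact LinearEquiv.finrank_map_eq e _

/-- If `ψ` is no translate of `φ`, then `idem ψ * ρ g * idem φ = 0` for all `g`, so irreducibility
forces the range of `idem φ` to vanish. -/
theorem IsType.exists_translate (hρ : IsType Φ ρ) (hirr : ρ.IsIrreducible) {φ ψ : X → ι}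
    (hφ : idem S ρ φ ≠ 0) (hψ : idem S ρ ψ ≠ 0) : ∃ q : Q, (fun x => φ (q⁻¹ • x)) = ψ := by
  obtain ⟨v, hv⟩ := DFunLike.ne_iff.1 hφ
  by_contra! hc
  refine hv (eq_bot_of_idem_eq_zero S hirr hψ fun g => ?_)
  exact LinearMap.congr_fun (hρ.idem_mul_rep_mul_idem_of_ne S g (hc g.right).symm) v

theorem idem_translate_ne_zero {φ : X → ι} (hφ : idem S ρ φ ≠ 0) (q : Q) :
    idem S ρ (fun x => φ (q⁻¹ • x)) ≠ 0 := by
  intro h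
  have := finrank_range_idem_translate S (ρ := ρ) q φ
  rw [h, LinearMap.range_zero, finrank_bot, eq_comm, Submodule.finrank_eq_zero,
    LinearMap.range_eq_bot] at this
  exact hφ this

theorem IsType.setOf_idem_ne_zero (hρ : IsType Φ ρ) (hirr : ρ.IsIrreducible) {φ : X → ι}
    (hφ : idem S ρ φ ≠ 0) :
    {ψ : X → ι | idem S ρ ψ ≠ 0} = {ψ | ∃ q : Q, (fun x => φ (q⁻¹ • x)) = ψ} := by
  ext ψ
  refine ⟨fun h => hρ.exists_translate S hirr hφ h, ?_⟩
  rintro ⟨q, rfl⟩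
  exact idem_translate_ne_zero S hφ q

/-- In the dimension formula only the translates of `φ` contribute; all contribute equally, and
orbit-stabilizer counts them. -/
theorem IsType.finrank_eq [Finite Q] (hρ : IsType Φ ρ) (hirr : ρ.IsIrreducible) {φ : X → ι}
    (hφ : idem S ρ φ ≠ 0) : finrank ℂ V = (fixer Q φ).index * (∏ x, d (φ x)) *
      finrank ℂ (LinearMap.range (idem S ρ φ)) := by
  classical
  rw [hρ.finrank_eq_sum S, ← ncard_translates, ← hρ.setOf_idem_ne_zero S hirr hφ, mul_assoc,
    Set.ncard_eq_toFinset_card', ← smul_eq_mul, ← Finset.sum_const]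
  symm
  refine Finset.sum_subset_zero_on_sdiff (Finset.subset_univ _) ?_ ?_
  · intro ψ hψ
    have : idem S ρ ψ = 0 := by simpa using hψ
    rw [this, LinearMap.range_zero, finrank_bot, mul_zero]
  · intro ψ hψ
    obtain ⟨q, rfl⟩ := hρ.exists_translate S hirr hφ (by simpa using hψ : idem S ρ ψ ≠ 0)
    rw [finrank_range_idem_translate]
    congr 1
    exact (Equiv.prod_comp (MulAction.toPerm (q⁻¹ : Q)) fun x => d (φ x)).symm

end Dimension

end PermWreath

end

noncomputable section

set_option linter.unusedSectionVars false

namespace PermWreath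

open Module Representation SemidirectProduct

variable {H Q X : Type*} [Group H] [Group Q] [MulAction Q X] [Fintype X] [dX : DecidableEq X]

/-! ### Types of irreducible representations -/

section Types

variable {V : Type*} [AddCommGroup V] [Module ℂ V] (ρ : Representation ℂ (PermWreath H Q X) V)

theorem coord_mul_inl (x : X) (r : MonoidAlgebra ℂ H) (b : X → H) :
    coord ρ x r * ρ (inl b) = ρ (inl b) * coord ρ x
      (MonoidAlgebra.of ℂ H (b x)⁻¹ * r * MonoidAlgebra.of ℂ H (b x)) := by
  induction r using MonoidAlgebra.induction_linear with
  | zero => simp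
  | add r s hr hs => simp only [map_add, mul_add, add_mul, hr, hs]
  | single h c =>
    rw [MonoidAlgebra.of_apply, MonoidAlgebra.of_apply, MonoidAlgebra.single_mul_single,
      MonoidAlgebra.single_mul_single, one_mul, mul_one, coord_single, coord_single,
      smul_mul_assoc, mul_smul_comm, ← map_mul, ← map_mul, ← map_mul, ← map_mul]
    have : Pi.mulSingle x h * b = b * Pi.mulSingle x ((b x)⁻¹ * h * b x) := by
      ext1 y
      rcases eq_or_ne y x with rfl | hy
      · simp [mul_assoc]
      · simp [hy]
    rw [this]

variable {A : Type*} [Ring A] [Algebra ℂ A] (Φ : MonoidAlgebra ℂ H →ₐ[ℂ] A)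

/-- The vectors on which the coordinate actions at `s` factor through `Φ`. -/
def typeSub (s : Set X) : Submodule ℂ V where
  carrier := {v | ∀ x ∈ s, ∀ r, Φ r = 0 → coord ρ x r v = 0}
  add_mem' ha hb x hx r hr := by rw [map_add, ha x hx r hr, hb x hx r hr, add_zero]
  zero_mem' x _ r _ := map_zero _
  smul_mem' c v hv x hx r hr := by rw [map_smul, hv x hx r hr, smul_zero]

theorem typeSub_inl (s : Set X) (b : X → H) (v : V) (hv : v ∈ typeSub ρ Φ s) :
    ρ (inl b) v ∈ typeSub ρ Φ s := fun x hx r hr => by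
  rw [← End.mul_apply, coord_mul_inl, End.mul_apply, hv x hx _ (by simp [hr]), map_zero]

theorem typeSub_univ (g : PermWreath H Q X) (v : V) (hv : v ∈ typeSub ρ Φ Set.univ) :
    ρ g v ∈ typeSub ρ Φ Set.univ := by
  rw [← inl_left_mul_inr_right g, map_mul]
  refine typeSub_inl ρ Φ _ _ _ fun x _ r hr => ?_
  have := LinearMap.congr_fun (inr_mul_coord ρ g.right (g.right⁻¹ • x) r) v
  rw [smul_inv_smul, End.mul_apply, End.mul_apply] at this
  rw [← this, hv _ trivial r hr, map_zero]

theorem matrixContinuous_coordRep [TopologicalSpace H] [TopologicalSpace Q]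
    (hc : ρ.MatrixContinuous) (x : X) : (coordRep ρ x).MatrixContinuous := by
  have h : Continuous fun h : H => (inl (Pi.mulSingle x h) : PermWreath H Q X) :=
    continuous_induced_rng.2 ((continuous_mulSingle (A := fun _ : X => H) x).prodMk
      continuous_const)
  exact fun v l => (hc v l).comp h

/-- If a family of irreducible representations of `H` contains all those of dimension at most
`dim V` up to equivalence, then the coordinate actions on `V` factor through it. -/
theorem isType_of_forall_exists_equiv [TopologicalSpace H] [TopologicalSpace Q]
    [FiniteDimensional ℂ V] (hirr : ρ.IsIrreducible) (hc : ρ.MatrixContinuous)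
    {ι : Type*} {d : ι → ℕ} (W : ∀ i, ContIrrep H (d i))
    (hW : ∀ n ≤ finrank ℂ V, ∀ c : ContIrrep H n, ∃ i, Nonempty (c.rep.Equiv (W i).rep)) :
    IsType (familyHom W) ρ := by
  -- Coordinates are added one at a time. The subspace for `s` is stable under `H^X`, so restricted
  -- to the factor at `y` it contains an irreducible representation of `H`, of dimension at most
  -- `dim V` and hence in the family. For `s = X` the subspace is also stable under `Q`, so it is
  -- all of `V`.
  have key : ∀ s : Finset X, typeSub ρ (familyHom W) (s : Set X) ≠ ⊥ := by
    intro s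
    induction s using Finset.induction_on with
    | empty =>
      obtain ⟨v, hv⟩ := @exists_ne V hirr.nontrivial 0
      exact (Submodule.ne_bot_iff _).2 ⟨v, fun x hx => absurd hx (by simp), hv⟩
    | insert y s _ ih =>
      obtain ⟨L, hL, hLi⟩ := exists_irreducible_le (coordRep ρ y) _
        (fun h v hv => typeSub_inl ρ _ _ (Pi.mulSingle y h) v hv) ih
      obtain ⟨c, ⟨e⟩⟩ := ContIrrep.exists_equiv L.toRepresentation hLi
        ((matrixContinuous_coordRep ρ hc y).sub L) rfl
      obtain ⟨i, ⟨e'⟩⟩ := hW _ (Submodule.finrank_le _) c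
      obtain ⟨v, hv⟩ := @exists_ne L.toSubmodule hLi.nontrivial 0
      refine (Submodule.ne_bot_iff _).2 ⟨v, fun x hx r hr => ?_, by simpa using hv⟩
      rcases Finset.mem_insert.1 hx with rfl | hx
      · have h1 := (e.trans e').toIntertwiningMap.map_asAlgebraHom r v
        have h2 : (W i).rep.asAlgebraHom r = 0 := congrFun hr i
        rw [h2, LinearMap.zero_apply] at h1
        have h3 := (e.trans e').toLinearEquiv.injective (h1.trans (map_zero _).symm)
        let incl : IntertwiningMap L.toRepresentation (coordRep ρ x) :=
          ⟨L.toSubmodule.subtype, fun g => rfl⟩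
        have h4 := incl.map_asAlgebraHom r v
        rw [h3, map_zero] at h4
        exact h4.symm
      · exact hL v.2 x hx r hr
  have h := hirr.eq_top (typeSub_univ ρ (familyHom W)) (by simpa using key Finset.univ)
  intro x r hr
  ext v
  have : v ∈ typeSub ρ (familyHom W) Set.univ := h ▸ Submodule.mem_top
  exact this x trivial r hr

end Types

/-! ### Existence of irreducible representations with a prescribed corner -/

section Existence

variable {V : Type*} [AddCommGroup V] [Module ℂ V] [FiniteDimensional ℂ V]
  {A : Type*} [Ring A] [Algebra ℂ A] {Φ : MonoidAlgebra ℂ H →ₐ[ℂ] A}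
  {ι : Type*} [Fintype ι] {d : ι → ℕ} (S : PrimitiveSystem Φ d)
  {ρ : Representation ℂ (PermWreath H Q X) V}

/-- The image `M` of `j` need not generate an irreducible representation, so an irreducible `Z` is
chosen inside the subrepresentation `K` whose `φ`-corner lies in `M` and whose corners at
non-translates of `φ` vanish. Some corner of `Z` is nonzero, hence so is the one at `φ`; it embeds
in the irreducible `σ`, hence is all of it. -/
theorem IsType.exists_subrepresentation (hρ : IsType Φ ρ) {φ : X → ι} {W : Type*}
    [AddCommGroup W] [Module ℂ W] {σ : Representation ℂ (fixer Q φ) W} (hσ : σ.IsIrreducible)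
    (j : W →ₗ[ℂ] V) (hj : Function.Injective j) (hjφ : ∀ w, idem S ρ φ (j w) = j w)
    (hjσ : ∀ (q : fixer Q φ) (w : W), j (σ q w) = ρ (inr (q : Q)) (j w)) :
    ∃ Z : Subrepresentation ρ, Z.toRepresentation.IsIrreducible ∧
      idem S Z.toRepresentation φ ≠ 0 ∧ Nonempty ((corner S Z.toRepresentation φ).Equiv σ) := by
  let M := LinearMap.range j
  have hM : M ≤ LinearMap.range (idem S ρ φ) := by
    rintro _ ⟨w, rfl⟩
    exact ⟨j w, hjφ w⟩
  have hs : ∀ q ∈ fixer Q φ, ∀ v ∈ M, ρ (inr q) v ∈ M := by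
    rintro q hq _ ⟨w, rfl⟩
    exact ⟨_, hjσ ⟨q, hq⟩ w⟩
  let K : Submodule ℂ V := maxSub S ρ φ M ⊓
    ⨅ ψ : {ψ : X → ι // ¬ ∃ q : Q, (fun x => φ (q⁻¹ • x)) = ψ}, maxSub S ρ ψ ⊥
  have hK : ∀ g, ∀ v ∈ K, ρ g v ∈ K := by
    rintro g v ⟨h1, h2⟩
    refine ⟨maxSub_stable S ρ φ M g v h1, (Submodule.mem_iInf _).2 fun ψ => ?_⟩
    exact maxSub_stable S ρ ψ ⊥ g v ((Submodule.mem_iInf _).1 h2 ψ)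
  have hMK : M ≤ K := by
    intro v hv
    refine ⟨fun g => hρ.idem_rep_mem S hM hs g hv, (Submodule.mem_iInf _).2 fun ψ g => ?_⟩
    rw [← hρ.idem_apply_of_mem S (hM hv)]
    exact LinearMap.congr_fun (hρ.idem_mul_rep_mul_idem_of_ne S g
      fun h => ψ.2 ⟨g.right, h.symm⟩) v
  have hK0 : K ≠ ⊥ := by
    obtain ⟨w, hw⟩ := @exists_ne W hσ.nontrivial 0
    exact (Submodule.ne_bot_iff _).2 ⟨j w, hMK ⟨w, rfl⟩, fun h => hw (hj (h.trans (map_zero j).symm))⟩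
  obtain ⟨Z, hZK, hZ⟩ := exists_irreducible_le ρ K hK hK0
  let incl : IntertwiningMap Z.toRepresentation ρ := ⟨Z.toSubmodule.subtype, fun g => rfl⟩
  have hZt : IsType Φ Z.toRepresentation := hρ.of_injective incl Subtype.val_injective
  have hidem : ∀ ψ (z : Z.toSubmodule), (idem S Z.toRepresentation ψ z : V) = idem S ρ ψ z :=
    fun ψ z => map_idem S incl ψ z
  have hne : idem S Z.toRepresentation φ ≠ 0 := by
    have := hZ.nontrivial
    obtain ⟨ψ, hψ⟩ := hZt.exists_idem_ne_zero S
    by_cases h : ∃ q : Q, (fun x => φ (q⁻¹ • x)) = ψ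
    · obtain ⟨q, rfl⟩ := h
      have := idem_translate_ne_zero S hψ q⁻¹
      simpa using this
    · refine absurd (LinearMap.ext fun z => Subtype.ext ?_) hψ
      have h1 := (Submodule.mem_iInf _).1 (hZK z.2).2 ⟨ψ, h⟩ 1
      rw [map_one, End.one_apply, Submodule.mem_bot] at h1
      rw [hidem, h1]
      rfl
  refine ⟨Z, hZ, hne, ?_⟩
  have hmem : ∀ z : LinearMap.range (idem S Z.toRepresentation φ), ((z : Z.toSubmodule) : V) ∈ M := by
    intro z
    have h1 := (hZK (z : Z.toSubmodule).2).1 1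
    rw [map_one, End.one_apply] at h1
    have h2 := hZt.idem_apply_of_mem S z.2
    rw [← h2, hidem]
    exact h1
  let J : W ≃ₗ[ℂ] M := LinearEquiv.ofInjective j hj
  have hJ : ∀ m, j (J.symm m) = m := fun m => congrArg Subtype.val (J.apply_symm_apply m)
  let f₀ : LinearMap.range (idem S Z.toRepresentation φ) →ₗ[ℂ] W :=
    J.symm.toLinearMap ∘ₗ LinearMap.codRestrict M
      (Z.toSubmodule.subtype ∘ₗ (LinearMap.range (idem S Z.toRepresentation φ)).subtype) hmem
  have hf₀ : ∀ z, j (f₀ z) = ((z : Z.toSubmodule) : V) := fun z => hJ _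
  let f : IntertwiningMap (corner S Z.toRepresentation φ) σ :=
    ⟨f₀, fun q => LinearMap.ext fun z => hj (by
      change j (f₀ (corner S Z.toRepresentation φ q z)) = j (σ q (f₀ z))
      rw [hjσ, hf₀, hf₀]
      rfl)⟩
  have hfi : Function.Injective f := fun z z' h => by
    have := (hf₀ z).symm.trans ((congrArg j h).trans (hf₀ z'))
    exact Subtype.ext (Subtype.ext this)
  refine ⟨f.ofBijective ⟨hfi, (IsIrreducible.surjective_or_eq_zero f).resolve_right fun h => ?_⟩⟩
  refine hne (LinearMap.ext fun z => ?_)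
  have h1 : f ⟨_, z, rfl⟩ = f 0 := by rw [h]; rfl
  exact congrArg Subtype.val (hfi h1)

end Existence

/-! ### A sufficiently large representation of the wreath product -/

section Model

open PiTensorProduct
open scoped TensorProduct

variable {U : Type*} [AddCommGroup U] [Module ℂ U] (τ : Representation ℂ H U)

variable (X U) in
/-- The permutation of the factors of a tensor power. -/
def permTensor (q : Q) : (⨂[ℂ] _x : X, U) →ₗ[ℂ] ⨂[ℂ] _x : X, U :=
  (PiTensorProduct.reindex ℂ (fun _ : X => U) (MulAction.toPerm q)).toLinearMap

@[simp] theorem permTensor_tprod (q : Q) (u : X → U) :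
    permTensor X U q (tprod ℂ u) = tprod ℂ fun x => u (q⁻¹ • x) :=
  PiTensorProduct.reindex_tprod _ _

variable (Q X) in
/-- The tensor power of a representation of `H`, as a representation of the wreath product. -/
def tensorPowerRep : Representation ℂ (PermWreath H Q X) (⨂[ℂ] _x : X, U) where
  toFun g := PiTensorProduct.map (fun x => τ (g.left x)) ∘ₗ
    permTensor X U g.right
  map_one' := by
    ext u
    simp only [one_left, Pi.one_apply, map_one, one_right, PiTensorProduct.map_one,
      LinearMap.compMultilinearMap_apply, LinearMap.comp_apply, permTensor_tprod, End.one_apply]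
    exact congrArg (PiTensorProduct.tprod ℂ) (funext fun x => congrArg u
      ((congrArg (· • x) inv_one).trans (one_smul Q x)))
  map_mul' g g' := by
    ext u
    simp only [LinearMap.compMultilinearMap_apply, LinearMap.comp_apply, permTensor_tprod,
      End.mul_apply, PiTensorProduct.map_tprod]
    refine congrArg (PiTensorProduct.tprod ℂ) (funext fun x => ?_)
    have : (g * g').right⁻¹ • x = g'.right⁻¹ • g.right⁻¹ • x := by
      rw [mul_right, mul_inv_rev, mul_smul]
    rw [this, mul_left, Pi.mul_apply, map_mul]
    rfl

theorem tensorPowerRep_tprod (g : PermWreath H Q X) (u : X → U) :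
    tensorPowerRep Q X τ g (tprod ℂ u) =
      tprod ℂ fun x => τ (g.left x) (u (g.right⁻¹ • x)) := by
  simp [tensorPowerRep]

variable (Q X) in
/-- The tensor product of the tensor power of `τ` and the regular representation of `Q`. -/
def modelRep : Representation ℂ (PermWreath H Q X) (Q → ⨂[ℂ] _x : X, U) where
  toFun g := LinearMap.pi fun p => tensorPowerRep Q X τ g ∘ₗ LinearMap.proj (g.right⁻¹ * p)
  map_one' := by
    ext1 f
    funext p
    simp
  map_mul' g g' := by
    ext1 f
    funext p
    simp [mul_assoc]

theorem modelRep_apply (g : PermWreath H Q X) (f : Q → ⨂[ℂ] _x : X, U) (p : Q) :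
    modelRep Q X τ g f p = tensorPowerRep Q X τ g (f (g.right⁻¹ * p)) := rfl

theorem coord_modelRep (x : X) (r : MonoidAlgebra ℂ H) (f : Q → ⨂[ℂ] _x : X, U) (p : Q) :
    coord (modelRep Q X τ) x r f p =
      PiTensorProduct.map (Pi.mulSingle x (τ.asAlgebraHom r)) (f p) := by
  have hmap : ∀ T : End ℂ U, PiTensorProduct.map (Pi.mulSingle x T) =
      PiTensorProduct.mapMultilinear ℂ (fun _ : X => U) (fun _ => U) (Function.update 1 x T) :=
    fun T => rfl
  rw [hmap]
  induction r using MonoidAlgebra.induction_linear with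
  | zero => simp
  | add r s hr hs =>
    rw [map_add, map_add, MultilinearMap.map_update_add, LinearMap.add_apply, LinearMap.add_apply,
      Pi.add_apply, hr, hs]
  | single h c =>
    rw [coord_single, asAlgebraHom_single, MultilinearMap.map_update_smul, LinearMap.smul_apply,
      LinearMap.smul_apply, Pi.smul_apply, modelRep_apply]
    congr 1
    simp only [right_inl, inv_one, one_mul, mapMultilinear_apply]
    induction f p using PiTensorProduct.induction_on with
    | smul_tprod c u =>
      rw [map_smul, map_smul, tensorPowerRep_tprod, PiTensorProduct.map_tprod]
      congr 2
      funext y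
      have : ((1 : Q)⁻¹ • y) = y := by rw [inv_one, one_smul]
      rw [right_inl, left_inl, this]
      rcases eq_or_ne y x with rfl | hy
      · simp
      · simp [hy]
    | add a b ha hb => rw [map_add, ha, hb, map_add]

theorem theta_modelRep (r : X → MonoidAlgebra ℂ H) : ∀ (f : Q → ⨂[ℂ] _x : X, U) (p : Q),
    theta (modelRep Q X τ) r f p =
      PiTensorProduct.map (fun x => τ.asAlgebraHom (r x)) (f p) := by
  induction r using Pi.mulSingle_induction_noncomm with
  | one =>
    intro f p
    simp only [map_one, End.one_apply, Pi.one_apply]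
    exact (LinearMap.congr_fun PiTensorProduct.map_one (f p)).symm
  | mul r s hr hs =>
    intro f p
    rw [map_mul, End.mul_apply, hr, hs]
    simp only [Pi.mul_apply, map_mul, PiTensorProduct.map_mul]
    rfl
  | single x m =>
    intro f p
    rw [theta_mulSingle, coord_modelRep]
    congr 2
    ext1 y
    rcases eq_or_ne y x with rfl | hy
    · simp
    · simp [hy]

theorem isType_modelRep {A : Type*} [Ring A] [Algebra ℂ A] {Φ : MonoidAlgebra ℂ H →ₐ[ℂ] A}
    (h : ∀ r, Φ r = 0 → τ.asAlgebraHom r = 0) : IsType Φ (modelRep Q X τ) := by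
  intro x r hr
  refine LinearMap.ext fun f => funext fun p => ?_
  rw [coord_modelRep, h r hr]
  have : PiTensorProduct.map (Pi.mulSingle x (0 : End ℂ U)) =
      PiTensorProduct.mapMultilinear ℂ (fun _ : X => U) (fun _ => U) (Function.update 1 x 0) := rfl
  rw [this, MultilinearMap.map_update_zero]
  rfl

/-- In a basis of `U` the value is a polynomial in matrix coefficients of `τ`. -/
theorem continuous_multilinear_rep [TopologicalSpace H] [FiniteDimensional ℂ U]
    (hτ : τ.MatrixContinuous) (m : MultilinearMap ℂ (fun _ : X => U) ℂ) (u : X → U) :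
    Continuous fun b : X → H => m fun x => τ (b x) (u x) := by
  let β := finBasis ℂ U
  have h : ∀ w : X → U, m w = ∑ f : X → Fin (finrank ℂ U),
      (∏ x, β.repr (w x) (f x)) • m fun x => β (f x) := by
    intro w
    conv_lhs => rw [show w = fun x => ∑ k, β.repr (w x) k • β k from
      funext fun x => (β.sum_repr (w x)).symm]
    rw [MultilinearMap.map_sum]
    refine Finset.sum_congr rfl fun f _ => ?_
    rw [← MultilinearMap.map_smul_univ]
  refine Continuous.congr ?_ fun b => (h _).symm
  simp only [smul_eq_mul]
  refine continuous_finsetSum _ fun f _ => Continuous.mul ?_ continuous_const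
  refine continuous_finsetProd _ fun x _ => ?_
  exact (hτ (u x) (β.coord (f x))).comp (continuous_apply x)

theorem matrixContinuous_modelRep [TopologicalSpace H] [TopologicalSpace Q] [DiscreteTopology Q]
    [Finite Q] [FiniteDimensional ℂ U] (hτ : τ.MatrixContinuous) :
    (modelRep Q X τ).MatrixContinuous := by
  classical
  have := Fintype.ofFinite Q
  intro v l
  have hv : ∀ v : Q → ⨂[ℂ] _x : X, U, v = ∑ p, Pi.single p (v p) := fun v =>
    (Finset.univ_sum_single v).symm
  rw [hv v]
  simp only [map_sum]
  refine continuous_finsetSum _ fun p _ => ?_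
  induction v p using PiTensorProduct.induction_on with
  | add a b ha hb =>
    simp only [Pi.single_add, map_add]
    exact ha.add hb
  | smul_tprod c u =>
    simp only [Pi.single_smul, map_smul]
    refine Continuous.const_smul ?_ c
    -- The element `(b, q)` moves the summand at `p` to `q * p`. As `Q` is discrete, continuity is
    -- needed only in `b` for fixed `q`, where the expression is multilinear.
    let F : (X → H) × Q → ℂ := fun y => ((l ∘ₗ LinearMap.single ℂ _ (y.2 * p)).compMultilinearMap
      (tprod ℂ : MultilinearMap ℂ (fun _ : X => U) _)) fun x => τ (y.1 x) (u (y.2⁻¹ • x))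
    have hF : Continuous F := continuous_prod_of_discrete_right.2 fun q =>
      continuous_multilinear_rep τ hτ ((l ∘ₗ LinearMap.single ℂ _ (q * p)).compMultilinearMap
        (tprod ℂ : MultilinearMap ℂ (fun _ : X => U) _)) fun x => u (q⁻¹ • x)
    have h1 : ∀ g : PermWreath H Q X, l (modelRep Q X τ g (Pi.single p (tprod ℂ u))) =
        F (g.left, g.right) := by
      intro g
      simp only [F, LinearMap.compMultilinearMap_apply, LinearMap.comp_apply,
        LinearMap.single_apply]
      congr 1
      funext p'
      rw [modelRep_apply]
      rcases eq_or_ne p' (g.right * p) with rfl | hp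
      · simp [tensorPowerRep_tprod]
      · rw [Pi.single_eq_of_ne hp, Pi.single_eq_of_ne, map_zero]
        rwa [Ne, inv_mul_eq_iff_eq_mul]
    exact (hF.comp continuous_induced_dom).congr fun g => (h1 g).symm

end Model

end PermWreath

end

noncomputable section

set_option linter.unusedSectionVars false

open Module Representation SemidirectProduct

/-! ### Families of irreducible representations -/

section Families

variable {G : Type*} [Group G] [TopologicalSpace G]

/-- Inequivalent elements of the dual have inequivalent representatives. -/
theorem isEmpty_equiv_out {i j : Σ n, IrrDual G n} (h : i ≠ j) :
    IsEmpty (i.2.out.rep.Equiv j.2.out.rep) := by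
  refine ⟨fun e => h ?_⟩
  obtain ⟨n, c⟩ := i
  obtain ⟨m, c'⟩ := j
  have hnm : n = m := by simpa using e.toLinearEquiv.finrank_eq
  subst hnm
  have : c = c' := by
    rw [← Quotient.out_eq c, ← Quotient.out_eq c']
    exact Quotient.sound ⟨e⟩
  rw [this]

theorem pairwiseInequivalent_out {ι : Type*} {f : ι → Σ n, IrrDual G n}
    (hf : Function.Injective f) :
    PairwiseInequivalent fun i => (f i).2.out :=
  fun _ _ h => isEmpty_equiv_out fun h' => h (hf h')

theorem equiv_out {n : ℕ} (c : ContIrrep G n) :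
    Nonempty (c.rep.Equiv (⟦c⟧ : IrrDual G n).out.rep) :=
  Setoid.symm (Quotient.mk_out c)

/-- The orthogonal idempotents lifted from the matrix algebras are linearly independent in the group
algebra, so a finite group has finitely many irreducible representations. -/
theorem PairwiseInequivalent.card_le [Finite G] {ι : Type*} [Fintype ι] {d : ι → ℕ}
    {W : ∀ i, ContIrrep G (d i)} (hW : PairwiseInequivalent W) :
    Fintype.card ι ≤ finrank ℂ (MonoidAlgebra ℂ G) := by
  classical
  obtain ⟨S⟩ := hW.nonempty_primitiveSystem
  have hli : LinearIndependent ℂ S.a := by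
    rw [Fintype.linearIndependent_iff]
    intro g hg k
    have h1 : familyHom W (S.a k * ∑ i, g i • S.a i) = g k • familyHom W (S.a k) := by
      rw [Finset.mul_sum, map_sum, Finset.sum_eq_single k]
      · rw [mul_smul_comm, map_smul, S.idem]
      · intro i _ hi
        have := S.ortho k i hi.symm 1
        rw [mul_one] at this
        rw [mul_smul_comm, map_smul, this, smul_zero]
      · simp
    rw [hg, mul_zero, map_zero] at h1
    exact (smul_eq_zero.1 h1.symm).resolve_right (S.map_a_ne_zero k)
  have : Module.Finite ℂ (MonoidAlgebra ℂ G) := inferInstance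
  exact hli.fintype_card_le_finrank

theorem finite_sigma_irrDual [Finite G] : Finite (Σ n, IrrDual G n) := by
  by_contra h
  rw [not_finite_iff_infinite] at h
  let f := Infinite.natEmbedding (Σ n, IrrDual G n)
  have := (pairwiseInequivalent_out (f := fun i : Fin (finrank ℂ (MonoidAlgebra ℂ G) + 1) => f i)
    (fun i j h => Fin.ext (f.injective h))).card_le
  simp at this

theorem finite_irrDual [Finite G] (n : ℕ) : Finite (IrrDual G n) :=
  have := finite_sigma_irrDual (G := G)
  Finite.of_injective (fun c : IrrDual G n => (⟨n, c⟩ : Σ n, IrrDual G n)) sigma_mk_injective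

theorem numIrreps_lt_top_iff {n : ℕ} : numIrreps G n < ⊤ ↔ Finite (IrrDual G n) :=
  ENat.card_lt_top

theorem isEmpty_irrDual_zero : IsEmpty (IrrDual G 0) :=
  ⟨fun c => absurd c.out.pos (lt_irrefl 0)⟩

theorem repZetaSeries_apply (n : ℕ) : repZetaSeries G n = Nat.card (IrrDual G n) := by
  change (if n = 0 then (0 : ℂ) else ((numIrreps G n).toNat : ℂ)) = _
  split_ifs with h
  · subst h
    have := isEmpty_irrDual_zero (G := G)
    simp
  · rfl

variable (G) in
/-- The trivial representation. -/
def ContIrrep.trivial : ContIrrep G 1 where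
  rep := 1
  continuous_rep v := continuous_const
  irreducible := by
    refine isIrreducible_iff.2 ⟨inferInstance, fun p _ => ?_⟩
    have h : finrank ℂ p ≤ 1 := by simpa using Submodule.finrank_le p
    rcases Nat.le_one_iff_eq_zero_or_eq_one.1 h with h | h
    · exact Or.inl (Submodule.finrank_eq_zero.1 h)
    · exact Or.inr (Submodule.eq_top_of_finrank_eq (by simpa using h))

variable {ι : Type*} {d : ι → ℕ} (W : ∀ i, ContIrrep G (d i))

/-- The direct sum of a finite family of representations. -/
def sumRep : Representation ℂ G (∀ i, Fin (d i) → ℂ) where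
  toFun g := LinearMap.pi fun i => (W i).rep g ∘ₗ LinearMap.proj i
  map_one' := by ext; simp
  map_mul' g h := by ext1 f; funext i; simp

theorem asAlgebraHom_sumRep (r : MonoidAlgebra ℂ G) (u : ∀ i, Fin (d i) → ℂ) (i : ι) :
    (sumRep W).asAlgebraHom r u i = familyHom W r i (u i) :=
  (⟨LinearMap.proj i, fun _ => rfl⟩ : IntertwiningMap (sumRep W) (W i).rep).map_asAlgebraHom r u

theorem matrixContinuous_sumRep [Fintype ι] : (sumRep W).MatrixContinuous := by
  classical
  intro v l
  have h : ∀ u, l u = ∑ i, l (Pi.single i (u i)) := fun u => by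
    conv_lhs => rw [← Finset.univ_sum_single u, map_sum]
  refine Continuous.congr ?_ fun g => (h _).symm
  exact continuous_finsetSum _ fun i _ =>
    (W i).matrixContinuous (v i) (l ∘ₗ LinearMap.single ℂ (fun i => Fin (d i) → ℂ) i)

end Families

/-! ### Existence of irreducible representations over a given function -/

namespace PermWreath

variable {H Q X : Type*} [Group H] [TopologicalSpace H] [Group Q] [Finite Q] [TopologicalSpace Q]
  [DiscreteTopology Q] [MulAction Q X] [Fintype X] [dX : DecidableEq X]
  {ι : Type*} [Fintype ι] {d : ι → ℕ} {W : ∀ i, ContIrrep H (d i)}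
  (S : PrimitiveSystem (familyHom W) d)

theorem exists_contIrrep_of_corner {V : Type*} [AddCommGroup V] [Module ℂ V]
    [FiniteDimensional ℂ V] {ρ : Representation ℂ (PermWreath H Q X) V}
    (hρ : IsType (familyHom W) ρ) (hc : ρ.MatrixContinuous) {φ : X → ι} {m : ℕ}
    (σ : ContIrrep (fixer Q φ) m) (j : (Fin m → ℂ) →ₗ[ℂ] V) (hj : Function.Injective j)
    (hjφ : ∀ w, idem S ρ φ (j w) = j w)
    (hjσ : ∀ (q : fixer Q φ) w, j (σ.rep q w) = ρ (inr (q : Q)) (j w)) :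
    ∃ c : ContIrrep (PermWreath H Q X) ((fixer Q φ).index * (∏ x, d (φ x)) * m),
      IsType (familyHom W) c.rep ∧ idem S c.rep φ ≠ 0 ∧
        Nonempty ((corner S c.rep φ).Equiv σ.rep) := by
  obtain ⟨Z, hZ, hne, ⟨e⟩⟩ := hρ.exists_subrepresentation S σ.irreducible j hj hjφ hjσ
  let incl : IntertwiningMap Z.toRepresentation ρ := ⟨Z.toSubmodule.subtype, fun g => rfl⟩
  have hincl : Function.Injective incl := Subtype.val_injective
  have hZt : IsType (familyHom W) Z.toRepresentation :=
    hρ.of_injective incl hincl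
  have hdim := hZt.finrank_eq S hZ hne
  have hm : finrank ℂ (LinearMap.range (idem S Z.toRepresentation φ)) = m := by
    simpa using e.toLinearEquiv.finrank_eq
  rw [hm] at hdim
  obtain ⟨c, ⟨f⟩⟩ := ContIrrep.exists_equiv Z.toRepresentation hZ
    (hc.sub Z) hdim
  obtain ⟨f'⟩ := nonempty_corner_equiv S f φ
  exact ⟨c, hZt.of_injective f.symm.toIntertwiningMap f.symm.toLinearEquiv.injective,
    idem_ne_zero_of_equiv S f hne, ⟨f'.symm.trans e⟩⟩

/-- Every irreducible representation of the isotropy group is the corner of an irreducible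
representation of the wreath product. -/
theorem exists_corner_equiv (φ : X → ι) {m : ℕ} (σ : ContIrrep (fixer Q φ) m) :
    ∃ c : ContIrrep (PermWreath H Q X) ((fixer Q φ).index * (∏ x, d (φ x)) * m),
      IsType (familyHom W) c.rep ∧ idem S c.rep φ ≠ 0 ∧
        Nonempty ((corner S c.rep φ).Equiv σ.rep) := by
  classical
  let U := ∀ i, Fin (d i) → ℂ
  let ρ := modelRep Q X (sumRep W)
  have hρ : IsType (familyHom W) ρ := isType_modelRep _ fun r hr => by
    refine LinearMap.ext fun u => funext fun i => ?_
    rw [asAlgebraHom_sumRep, hr]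
    rfl
  have ht : ∀ i, ∃ t : U, (sumRep W).asAlgebraHom (S.a i) t = t ∧ t ≠ 0 := by
    intro i
    have h0 : (sumRep W).asAlgebraHom (S.a i) ≠ 0 := by
      intro h
      refine S.map_a_ne_zero i (funext fun k => LinearMap.ext fun v => ?_)
      have := asAlgebraHom_sumRep W (S.a i) (Pi.single k v) k
      rw [h, Pi.single_eq_same] at this
      exact this.symm
    obtain ⟨u, hu⟩ := DFunLike.ne_iff.1 h0
    refine ⟨(sumRep W).asAlgebraHom (S.a i) u, ?_, hu⟩
    funext k
    rw [asAlgebraHom_sumRep, asAlgebraHom_sumRep, ← End.mul_apply, ← Pi.mul_apply, ← map_mul,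
      S.idem]
  choose t hat ht0 using ht
  -- The vector at `x` depends only on `φ x`, so `T` is invariant under `fixer Q φ`; it is also
  -- fixed by the idempotent of `φ`.
  let T : PiTensorProduct ℂ (fun _ : X => U) := PiTensorProduct.tprod ℂ fun x => t (φ x)
  have hT0 : T ≠ 0 := by
    choose l hl using fun i => Module.Projective.exists_dual_eq_one ℂ (ht0 i)
    let m := (MultilinearMap.mkPiAlgebra ℂ X ℂ).compLinearMap fun x => l (φ x)
    intro h
    have h1 : PiTensorProduct.lift m T = 1 := by
      rw [PiTensorProduct.lift.tprod, MultilinearMap.compLinearMap_apply,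
        MultilinearMap.mkPiAlgebra_apply]
      exact Finset.prod_eq_one fun x _ => hl _
    rw [h, map_zero] at h1
    exact zero_ne_one h1
  have hTq : ∀ q ∈ fixer Q φ, tensorPowerRep Q X (sumRep W) (inr q) T = T := by
    intro q hq
    rw [tensorPowerRep_tprod]
    congr 1
    funext x
    rw [left_inr, right_inr, Pi.one_apply, map_one, End.one_apply]
    exact congrArg t (inv_mem hq x)
  have hTφ : PiTensorProduct.map (fun x => (sumRep W).asAlgebraHom (S.a (φ x))) T = T := by
    rw [PiTensorProduct.map_tprod]
    exact congrArg _ (funext fun x => hat _)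
  have hσ := σ.irreducible
  obtain ⟨w₀, hw₀⟩ := @exists_ne _ hσ.nontrivial 0
  obtain ⟨l, hl⟩ := Module.Projective.exists_dual_ne_zero ℂ hw₀
  -- The embedding of `σ` in the regular representation by the matrix coefficients `p ↦ l (σ(p⁻¹)
  -- w)`, extended by zero to `Q` and tensored with `T`. Its kernel is stable and omits `w₀`, so it
  -- is zero.
  let j : (Fin m → ℂ) →ₗ[ℂ] (Q → PiTensorProduct ℂ (fun _ : X => U)) :=
    LinearMap.pi fun p => if h : p ∈ fixer Q φ then
      (l ∘ₗ σ.rep (⟨p, h⟩⁻¹ : fixer Q φ)).smulRight T else 0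
  have hj₁ : ∀ w (p : fixer Q φ), j w p = l (σ.rep p⁻¹ w) • T := by
    intro w p
    simp [j]
  have hj₂ : ∀ w, ∀ p ∉ fixer Q φ, j w p = 0 := by
    intro w p hp
    simp [j, hp]
  have hj : Function.Injective j := by
    have hker : LinearMap.ker j = ⊥ := by
      refine ((isIrreducible_iff.1 hσ).2 (LinearMap.ker j) fun q w hw => ?_).resolve_right ?_
      · have hw : j w = 0 := hw
        refine funext fun p => ?_
        by_cases hp : p ∈ fixer Q φ
        · have h1 := hj₁ (σ.rep q w) ⟨p, hp⟩
          have h2 := hj₁ w (q⁻¹ * ⟨p, hp⟩)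
          rw [hw, mul_inv_rev, inv_inv, map_mul, End.mul_apply] at h2
          exact h1.trans h2.symm
        · exact hj₂ _ _ hp
      · intro h
        have h1 : j w₀ = 0 := (h ▸ Submodule.mem_top : w₀ ∈ LinearMap.ker j)
        have h2 := hj₁ w₀ 1
        rw [h1, inv_one, map_one, End.one_apply] at h2
        exact (smul_ne_zero hl hT0) h2.symm
    exact LinearMap.ker_eq_bot.1 hker
  have hjφ : ∀ w, idem S ρ φ (j w) = j w := by
    intro w
    funext p
    rw [idem, theta_modelRep]
    by_cases hp : p ∈ fixer Q φ
    · rw [hj₁ w ⟨p, hp⟩, map_smul, hTφ]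
    · rw [hj₂ w p hp, map_zero]
  have hjσ : ∀ (q : fixer Q φ) (w : Fin m → ℂ), j (σ.rep q w) = ρ (inr (q : Q)) (j w) := by
    intro q w
    funext p
    rw [modelRep_apply, right_inr]
    by_cases hp : p ∈ fixer Q φ
    · rw [hj₁ _ ⟨p, hp⟩, show (q : Q)⁻¹ * p = ((q⁻¹ * ⟨p, hp⟩ : fixer Q φ) : Q) from rfl, hj₁,
        map_smul, hTq q q.2, mul_inv_rev, inv_inv, map_mul, End.mul_apply]
    · rw [hj₂ _ p hp, hj₂, map_zero]
      rwa [Subgroup.mul_mem_cancel_left _ (inv_mem q.2)]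
  exact exists_contIrrep_of_corner S hρ
    (matrixContinuous_modelRep (sumRep W) (matrixContinuous_sumRep W)) σ j hj hjφ hjσ

end PermWreath

end

noncomputable section

set_option linter.unusedSectionVars false

open Module Representation SemidirectProduct

/-! ### Counting the irreducible representations of the wreath product -/

namespace PermWreath

variable {H Q X : Type*} [Group H] [TopologicalSpace H] [Group Q] [TopologicalSpace Q]
  [MulAction Q X] [Fintype X] [dX : DecidableEq X]
  {ι : Type*} [Fintype ι] {d : ι → ℕ} {W : ∀ i, ContIrrep H (d i)}
  (S : PrimitiveSystem (familyHom W) d)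

/-- An irreducible representation of the wreath product of type `W` lies over `φ`. -/
def Contains (φ : X → ι) {n : ℕ} (c : IrrDual (PermWreath H Q X) n) : Prop :=
  IsType (familyHom W) c.out.rep ∧ idem S c.out.rep φ ≠ 0

theorem contains_mk {φ : X → ι} {n : ℕ} {c : ContIrrep (PermWreath H Q X) n}
    (h : IsType (familyHom W) c.rep) (h0 : idem S c.rep φ ≠ 0) :
    Contains S φ (⟦c⟧ : IrrDual (PermWreath H Q X) n) := by
  obtain ⟨e⟩ := equiv_out c
  exact ⟨h.of_injective e.symm.toIntertwiningMap e.symm.toLinearEquiv.injective,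
    idem_ne_zero_of_equiv S e h0⟩

variable [Finite Q]

theorem Contains.exists_eq {φ : X → ι} {n : ℕ} {c : IrrDual (PermWreath H Q X) n}
    (h : Contains S φ c) : n = (fixer Q φ).index * (∏ x, d (φ x)) *
      finrank ℂ (LinearMap.range (idem S c.out.rep φ)) := by
  simpa using h.1.finrank_eq S c.out.irreducible h.2

theorem index_fixer_pos (φ : X → ι) : 0 < (fixer Q φ).index :=
  Nat.pos_of_ne_zero Subgroup.FiniteIndex.index_ne_zero

/-- The functions below an irreducible representation form one `Q`-orbit. This multiplicity accounts
for the `-1` in the exponent of `[Q : Q_P]^(-1-s)`. -/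
theorem Contains.ncard_eq {φ : X → ι} {n : ℕ} {c : IrrDual (PermWreath H Q X) n}
    (h : Contains S φ c) : {ψ : X → ι | Contains S ψ c}.ncard = (fixer Q φ).index := by
  rw [← ncard_translates, ← h.1.setOf_idem_ne_zero S c.out.irreducible h.2]
  congr 1
  ext ψ
  exact ⟨fun h' => h'.2, fun h' => ⟨h.1, h'⟩⟩

theorem exists_contains {n : ℕ} {c : IrrDual (PermWreath H Q X) n}
    (h : IsType (familyHom W) c.out.rep) : ∃ φ, Contains S φ c := by
  have := c.out.irreducible.nontrivial
  obtain ⟨φ, hφ⟩ := h.exists_idem_ne_zero S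
  exact ⟨φ, h, hφ⟩

variable [DiscreteTopology Q]

/-- The Clifford correspondence for wreath products. -/
theorem nonempty_contains_equiv (φ : X → ι) (m : ℕ) :
    Nonempty ({c : IrrDual (PermWreath H Q X) ((fixer Q φ).index * (∏ x, d (φ x)) * m) //
      Contains S φ c} ≃ IrrDual (fixer Q φ) m) := by
  have hpos : ∀ c : {c : IrrDual (PermWreath H Q X) ((fixer Q φ).index * (∏ x, d (φ x)) * m) //
      Contains S φ c}, finrank ℂ (LinearMap.range (idem S c.1.out.rep φ)) = m := by
    intro c
    have h1 := c.2.exists_eq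
    have h2 := c.1.out.pos
    exact (Nat.eq_of_mul_eq_mul_left (Nat.pos_of_mul_pos_right h2) h1).symm
  have hex : ∀ c : {c : IrrDual (PermWreath H Q X) ((fixer Q φ).index * (∏ x, d (φ x)) * m) //
      Contains S φ c}, ∃ σ : ContIrrep (fixer Q φ) m,
        Nonempty ((corner S c.1.out.rep φ).Equiv σ.rep) := fun c =>
    ContIrrep.exists_equiv _ (c.2.1.corner_isIrreducible S c.1.out.irreducible c.2.2)
      (matrixContinuous_of_discrete _) (hpos c)
  choose σ hσ using hex
  refine ⟨Equiv.ofBijective (fun c => (⟦σ c⟧ : IrrDual (fixer Q φ) m)) ⟨?_, ?_⟩⟩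
  · intro c c' h
    obtain ⟨e⟩ : Nonempty ((σ c).rep.Equiv (σ c').rep) := Quotient.exact h
    obtain ⟨f⟩ := hσ c
    obtain ⟨f'⟩ := hσ c'
    have h1 := c.2.1.nonempty_equiv S c'.2.1 c.1.out.irreducible c'.1.out.irreducible c.2.2
      ((f.trans e).trans f'.symm)
    have h2 : (⟦c.1.out⟧ : IrrDual (PermWreath H Q X) _) = ⟦c'.1.out⟧ := Quotient.sound h1
    exact Subtype.ext ((Quotient.out_eq c.1).symm.trans (h2.trans (Quotient.out_eq c'.1)))
  · intro τ
    obtain ⟨c, hc, h0, ⟨e⟩⟩ := exists_corner_equiv (Q := Q) S φ τ.out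
    refine ⟨⟨⟦c⟧, contains_mk S hc h0⟩, ?_⟩
    obtain ⟨f⟩ := hσ ⟨⟦c⟧, contains_mk S hc h0⟩
    obtain ⟨g⟩ := equiv_out c
    obtain ⟨g'⟩ := nonempty_corner_equiv S g φ
    rw [← Quotient.out_eq τ]
    exact Quotient.sound ⟨(f.symm.trans g'.symm).trans e⟩

theorem finite_contains (φ : X → ι) (n : ℕ) :
    Finite {c : IrrDual (PermWreath H Q X) n // Contains S φ c} := by
  rcases isEmpty_or_nonempty {c : IrrDual (PermWreath H Q X) n // Contains S φ c} with h | ⟨⟨c, hc⟩⟩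
  · infer_instance
  · obtain ⟨m, hm⟩ : ∃ m, n = (fixer Q φ).index * (∏ x, d (φ x)) * m := ⟨_, hc.exists_eq⟩
    subst hm
    have := finite_irrDual (G := fixer Q φ) m
    exact Finite.of_equiv _ (nonempty_contains_equiv S φ m).some.symm

theorem natCard_contains_eq_zero {φ : X → ι} {n : ℕ}
    (h : ¬ (fixer Q φ).index * (∏ x, d (φ x)) ∣ n) :
    Nat.card {c : IrrDual (PermWreath H Q X) n // Contains S φ c} = 0 := by
  have : IsEmpty {c : IrrDual (PermWreath H Q X) n // Contains S φ c} :=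
    ⟨fun c => h ⟨_, c.2.exists_eq⟩⟩
  simp

theorem natCard_contains (φ : X → ι) (m : ℕ) :
    Nat.card {c : IrrDual (PermWreath H Q X) ((fixer Q φ).index * (∏ x, d (φ x)) * m) //
      Contains S φ c} = Nat.card (IrrDual (fixer Q φ) m) :=
  Nat.card_congr (nonempty_contains_equiv S φ m).some

section Total

variable {n : ℕ}

theorem finite_irrDual_of_forall_isType (S : PrimitiveSystem (familyHom W) d)
    (h : ∀ c : IrrDual (PermWreath H Q X) n, IsType (familyHom W) c.out.rep) :
    Finite (IrrDual (PermWreath H Q X) n) := by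
  have := fun φ : X → ι => finite_contains (Q := Q) S φ n
  refine Finite.of_surjective
    (fun x : (Σ φ : X → ι, {c : IrrDual (PermWreath H Q X) n // Contains S φ c}) => x.2.1) ?_
  intro c
  obtain ⟨φ, hφ⟩ := exists_contains S (h c)
  exact ⟨⟨φ, c, hφ⟩, rfl⟩

/-- The number of irreducible representations as a sum over the functions `X → ι`. -/
theorem natCard_irrDual_eq_sum
    (h : ∀ c : IrrDual (PermWreath H Q X) n, IsType (familyHom W) c.out.rep) :
    (Nat.card (IrrDual (PermWreath H Q X) n) : ℂ) = ∑ φ : X → ι,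
      ((fixer Q φ).index : ℂ)⁻¹ *
        Nat.card {c : IrrDual (PermWreath H Q X) n // Contains S φ c} := by
  classical
  have := finite_irrDual_of_forall_isType S h
  have := Fintype.ofFinite (IrrDual (PermWreath H Q X) n)
  have h1 : ∀ φ : X → ι, (Nat.card {c : IrrDual (PermWreath H Q X) n // Contains S φ c} : ℂ) =
      ∑ c : IrrDual (PermWreath H Q X) n, if Contains S φ c then 1 else 0 := by
    intro φ
    rw [Nat.card_eq_fintype_card, Fintype.card_subtype, Finset.sum_boole]
  simp only [h1, Finset.mul_sum]
  rw [Finset.sum_comm, Nat.card_eq_fintype_card, Fintype.card, ← nsmul_one,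
    ← Finset.sum_const]
  refine Finset.sum_congr rfl fun c _ => ?_
  obtain ⟨φ, hφ⟩ := exists_contains S (h c)
  -- All functions below `c` have isotropy groups of the same index, equal to the number of these
  -- functions, so the weights of `c` sum to one.
  have h2 : ∀ ψ : X → ι, ((fixer Q ψ).index : ℂ)⁻¹ * (if Contains S ψ c then 1 else 0) =
      if Contains S ψ c then ((fixer Q φ).index : ℂ)⁻¹ else 0 := by
    intro ψ
    split_ifs with hψ
    · rw [mul_one, ← hψ.ncard_eq, hφ.ncard_eq]
    · rw [mul_zero]
  simp only [h2]
  rw [← Finset.sum_filter, Finset.sum_const, nsmul_eq_mul]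
  have h3 := hφ.ncard_eq
  rw [Set.ncard_eq_toFinset_card', Set.toFinset_ofPred] at h3
  rw [h3, mul_inv_cancel₀]
  exact Nat.cast_ne_zero.2 (index_fixer_pos φ).ne'

/-- A lower bound for the number of irreducible representations. -/
theorem card_filter_le [Finite (IrrDual (PermWreath H Q X) n)]
    [DecidablePred fun φ : X → ι => (fixer Q φ).index * (∏ x, d (φ x)) = n]
    (S : PrimitiveSystem (familyHom W) d) :
    (Finset.univ.filter fun φ : X → ι => (fixer Q φ).index * (∏ x, d (φ x)) = n).card ≤
      Nat.card Q * Nat.card (IrrDual (PermWreath H Q X) n) := by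
  classical
  have := Fintype.ofFinite (IrrDual (PermWreath H Q X) n)
  -- The trivial representation of the isotropy group yields an irreducible representation over `φ`
  -- of degree exactly `n`. A fibre of this choice lies in a single `Q`-orbit, so it has at most
  -- `|Q|` elements.
  have hex : ∀ φ ∈ Finset.univ.filter fun φ : X → ι => (fixer Q φ).index * (∏ x, d (φ x)) = n,
      ∃ c : IrrDual (PermWreath H Q X) n, Contains S φ c := by
    intro φ hφ
    obtain rfl := (Finset.mem_filter.1 hφ).2
    have := (nonempty_contains_equiv (Q := Q) S φ 1).some.symm ⟦ContIrrep.trivial _⟧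
    rw [mul_one] at this
    exact ⟨this.1, this.2⟩
  rcases isEmpty_or_nonempty (IrrDual (PermWreath H Q X) n) with h0 | h0
  · rw [Finset.eq_empty_of_forall_notMem fun φ hφ => isEmptyElim (hex φ hφ).choose]
    simp
  choose! f hf using hex
  rw [mul_comm, Nat.card_eq_fintype_card (α := IrrDual (PermWreath H Q X) n), Fintype.card,
    ← smul_eq_mul, ← Finset.sum_const]
  rw [Finset.card_eq_sum_card_fiberwise (f := f) (t := Finset.univ) (by simp)]
  refine Finset.sum_le_sum fun c _ => ?_
  rcases Finset.eq_empty_or_nonempty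
    (({φ ∈ Finset.univ.filter fun φ : X → ι => (fixer Q φ).index * (∏ x, d (φ x)) = n |
      f φ = c} : Finset (X → ι))) with h0 | ⟨φ, hφ⟩
  · rw [h0]; simp
  · obtain ⟨hφ1, rfl⟩ := Finset.mem_filter.1 hφ
    have h1 := (hf φ hφ1).ncard_eq
    calc _ ≤ (Finset.univ.filter fun ψ => Contains S ψ (f φ)).card := by
          refine Finset.card_le_card fun ψ hψ => ?_
          obtain ⟨hψ, h2⟩ := Finset.mem_filter.1 hψ
          exact Finset.mem_filter.2 ⟨Finset.mem_univ _, h2 ▸ hf ψ hψ⟩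
      _ = (fixer Q φ).index := by
          rw [← h1, Set.ncard_eq_toFinset_card', Set.toFinset_ofPred]
      _ ≤ Nat.card Q := Nat.le_of_dvd Nat.card_pos (Subgroup.index_dvd_card _)

end Total

end PermWreath

end

noncomputable section

set_option linter.unusedSectionVars false

open Module Representation

/-! ### Formal Dirichlet series -/

namespace ArithmeticFunction

/-- The formal Dirichlet series `m^{-s}`. -/
def dirac (m : ℕ) : ArithmeticFunction ℂ where
  toFun n := if n = 0 then 0 else if n = m then 1 else 0
  map_zero' := if_pos rfl

theorem dirac_apply {m n : ℕ} (hm : m ≠ 0) : dirac m n = if n = m then 1 else 0 := by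
  change (if n = 0 then (0 : ℂ) else if n = m then 1 else 0) = _
  split_ifs with h0 h1 <;> first | rfl | exact absurd (h1 ▸ h0) hm

theorem dirac_one : dirac 1 = 1 := by
  ext n
  rw [dirac_apply one_ne_zero, one_apply]

theorem mul_dirac_apply_of_not_dvd (f : ArithmeticFunction ℂ) {m n : ℕ} (hm : m ≠ 0)
    (h : ¬ m ∣ n) : (f * dirac m) n = 0 := by
  rw [mul_apply]
  refine Finset.sum_eq_zero fun x hx => ?_
  rw [dirac_apply hm, if_neg, mul_zero]
  rintro rfl
  exact h ((Nat.mem_divisorsAntidiagonal.1 hx).1 ▸ Dvd.intro_left _ rfl)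

theorem mul_dirac_apply_mul (f : ArithmeticFunction ℂ) {m k : ℕ} (hm : m ≠ 0) :
    (f * dirac m) (m * k) = f k := by
  rcases eq_or_ne k 0 with rfl | hk
  · simp
  rw [mul_apply, Finset.sum_eq_single (k, m)]
  · rw [dirac_apply hm, if_pos rfl, mul_one]
  · intro x hx hne
    rw [dirac_apply hm, if_neg, mul_zero]
    rintro rfl
    refine hne (Prod.ext ?_ rfl)
    have := (Nat.mem_divisorsAntidiagonal.1 hx).1
    rw [mul_comm] at this
    exact Nat.eq_of_mul_eq_mul_left (Nat.pos_of_ne_zero hm) this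
  · intro h
    exact absurd (Nat.mem_divisorsAntidiagonal.2 ⟨mul_comm _ _, mul_ne_zero hm hk⟩) h

theorem dirac_mul_dirac {m m' : ℕ} (hm : m ≠ 0) (hm' : m' ≠ 0) :
    dirac m * dirac m' = dirac (m * m') := by
  ext n
  by_cases h : m' ∣ n
  · obtain ⟨k, rfl⟩ := h
    rw [mul_dirac_apply_mul _ hm', dirac_apply hm, dirac_apply (mul_ne_zero hm hm')]
    have : m' * k = m * m' ↔ k = m := by
      rw [mul_comm m, Nat.mul_right_inj hm']
    simp only [this]
  · rw [mul_dirac_apply_of_not_dvd _ hm' h, dirac_apply (mul_ne_zero hm hm'), if_neg]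
    rintro rfl
    exact h (Dvd.intro_left _ rfl)

theorem prod_dirac {α : Type*} (s : Finset α) (f : α → ℕ) (hf : ∀ a ∈ s, f a ≠ 0) :
    ∏ a ∈ s, dirac (f a) = dirac (∏ a ∈ s, f a) := by
  classical
  induction s using Finset.induction_on with
  | empty => simp [dirac_one]
  | insert a s ha ih =>
    rw [Finset.prod_insert ha, Finset.prod_insert ha, ih fun b hb => hf b (Finset.mem_insert_of_mem hb),
      dirac_mul_dirac (hf a (Finset.mem_insert_self a s))]
    exact Finset.prod_ne_zero_iff.2 fun b hb => hf b (Finset.mem_insert_of_mem hb)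

theorem dirichletPow_eq (m : ℕ) : dirichletPow m = (m : ℂ)⁻¹ • dirac m := by
  ext n
  change (if n = 0 then (0 : ℂ) else if n = m then (m : ℂ)⁻¹ else 0) =
    (m : ℂ)⁻¹ • (if n = 0 then (0 : ℂ) else if n = m then 1 else 0)
  split_ifs <;> simp

theorem finset_sum_apply {α : Type*} (s : Finset α) (f : α → ArithmeticFunction ℂ) (n : ℕ) :
    (∑ a ∈ s, f a) n = ∑ a ∈ s, f a n := by
  classical
  induction s using Finset.induction_on with
  | empty => simp
  | insert a s ha ih => rw [Finset.sum_insert ha, Finset.sum_insert ha, add_apply, ih]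

theorem dirichletDilate_apply (k : ℕ) (f : ArithmeticFunction ℂ) (n : ℕ) :
    dirichletDilate k f n = ∑ d ∈ n.divisors with d ^ k = n, f d := rfl

theorem dirichletDilate_sum {α : Type*} (s : Finset α) (k : ℕ) (f : α → ArithmeticFunction ℂ) :
    dirichletDilate k (∑ a ∈ s, f a) = ∑ a ∈ s, dirichletDilate k (f a) := by
  ext n
  rw [finset_sum_apply]
  simp only [dirichletDilate_apply, finset_sum_apply]
  exact Finset.sum_comm

theorem dirichletDilate_dirac {k m : ℕ} (hk : k ≠ 0) (hm : m ≠ 0) :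
    dirichletDilate k (dirac m) = dirac (m ^ k) := by
  ext n
  rw [dirichletDilate_apply, dirac_apply (pow_ne_zero k hm)]
  simp only [dirac_apply hm]
  rw [Finset.sum_ite_eq']
  congr 1
  rw [Finset.mem_filter, Nat.mem_divisors, eq_comm (a := n)]
  refine propext ⟨fun h => h.2, fun h => ⟨⟨h ▸ dvd_pow_self m hk, ?_⟩, h⟩⟩
  rw [← h]
  exact pow_ne_zero k hm

/-- Agreement of the coefficients of index at most `n`. -/
def AgreeUpTo (n : ℕ) (f g : ArithmeticFunction ℂ) : Prop := ∀ k ≤ n, f k = g k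

namespace AgreeUpTo

variable {n : ℕ} {f f' g g' : ArithmeticFunction ℂ}

theorem mul (hf : AgreeUpTo n f f') (hg : AgreeUpTo n g g') : AgreeUpTo n (f * g) (f' * g') := by
  intro k hk
  rw [mul_apply, mul_apply]
  refine Finset.sum_congr rfl fun x hx => ?_
  obtain ⟨h1, h2⟩ := Nat.mem_divisorsAntidiagonal.1 hx
  rw [hf _ ((Nat.le_of_dvd (Nat.pos_of_ne_zero h2) ⟨_, h1.symm⟩).trans hk),
    hg _ ((Nat.le_of_dvd (Nat.pos_of_ne_zero h2) (Dvd.intro_left _ h1)).trans hk)]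

theorem sum {α : Type*} {s : Finset α} {f g : α → ArithmeticFunction ℂ}
    (h : ∀ a ∈ s, AgreeUpTo n (f a) (g a)) : AgreeUpTo n (∑ a ∈ s, f a) (∑ a ∈ s, g a) := by
  intro k hk
  rw [finset_sum_apply, finset_sum_apply]
  exact Finset.sum_congr rfl fun a ha => h a ha k hk

theorem prod {α : Type*} {s : Finset α} {f g : α → ArithmeticFunction ℂ}
    (h : ∀ a ∈ s, AgreeUpTo n (f a) (g a)) : AgreeUpTo n (∏ a ∈ s, f a) (∏ a ∈ s, g a) := by
  classical
  induction s using Finset.induction_on with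
  | empty => exact fun _ _ => rfl
  | insert a s ha ih =>
    rw [Finset.prod_insert ha, Finset.prod_insert ha]
    exact (h a (Finset.mem_insert_self a s)).mul
      (ih fun b hb => h b (Finset.mem_insert_of_mem hb))

theorem zsmul (h : AgreeUpTo n f g) (c : ℤ) : AgreeUpTo n (c • f) (c • g) := by
  intro k hk
  rw [zsmul_eq_mul, zsmul_eq_mul]
  exact (mul (fun _ _ => rfl : AgreeUpTo n (c : ArithmeticFunction ℂ) c) h) k hk

theorem dilate (h : AgreeUpTo n f g) (k : ℕ) :
    AgreeUpTo n (dirichletDilate k f) (dirichletDilate k g) := by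
  intro m hm
  rw [dirichletDilate_apply, dirichletDilate_apply]
  refine Finset.sum_congr rfl fun d hd => h d ?_
  exact (Nat.divisor_le (Finset.mem_filter.1 hd).1).trans hm

end AgreeUpTo

end ArithmeticFunction

/-! ### Orbit partitions -/

namespace OrbitPartition

variable {Q X : Type*} [Group Q] [MulAction Q X] {ι : Type*}

theorem mem_stab {P : OrbitPartition Q X} {q : Q} :
    q ∈ P.stab ↔ ∀ B ∈ P.1.classes, q • B = B := by
  simp [stab, Subgroup.mem_iInf, MulAction.mem_stabilizer_iff]

/-- The partition into orbits of the isotropy group of a function. -/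
def ofFun (Q : Type*) [Group Q] [MulAction Q X] (φ : X → ι) : OrbitPartition Q X :=
  ⟨MulAction.orbitRel (fixer Q φ) X, fixer Q φ, rfl⟩

theorem ofFun_rel {φ : X → ι} {x y : X} :
    (ofFun Q φ).1 x y ↔ ∃ q ∈ fixer Q φ, q • y = x := by
  change MulAction.orbitRel (fixer Q φ) X x y ↔ _
  rw [MulAction.orbitRel_apply]
  exact ⟨fun ⟨q, hq⟩ => ⟨q, q.2, hq⟩, fun ⟨q, hq, h⟩ => ⟨⟨q, hq⟩, h⟩⟩

/-- If `P` is the orbit partition of `S` and `φ` is constant on its blocks, then `S` lies in the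
isotropy group of `φ`. This is where `P` has to be an orbit partition. -/
theorem le_ofFun_iff {P : OrbitPartition Q X} {φ : X → ι} :
    P ≤ ofFun Q φ ↔ P.1 ≤ Setoid.ker φ := by
  constructor
  · intro h x y hxy
    obtain ⟨q, hq, rfl⟩ := ofFun_rel.1 (h hxy)
    exact hq y
  · intro h x y hxy
    obtain ⟨P, S, rfl⟩ := P
    obtain ⟨q, rfl⟩ := MulAction.orbitRel_apply.1 hxy
    exact ofFun_rel.2 ⟨q, fun z => h (MulAction.orbitRel_apply.2 ⟨q, rfl⟩), rfl⟩

/-- Preserving each orbit of the isotropy group already preserves `φ`, which is constant on these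
orbits. Thus the isotropy group depends on `φ` only through `ofFun Q φ`. -/
theorem stab_ofFun (φ : X → ι) : (ofFun Q φ).stab = fixer Q φ := by
  ext q
  rw [mem_stab]
  constructor
  · intro h x
    have h1 := h _ (Setoid.mem_classes (ofFun Q φ).1 x)
    have h2 : q • x ∈ q • {y | (ofFun Q φ).1 y x} :=
      Set.smul_mem_smul_set (Set.mem_ofPred_eq (p := fun y => (ofFun Q φ).1 y x) ▸ Setoid.refl' _ x)
    rw [h1] at h2
    obtain ⟨q', hq', h3⟩ := ofFun_rel.1 h2
    rw [← h3]
    exact hq' x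
  · rintro hq _ ⟨x, rfl⟩
    ext y
    rw [Set.mem_smul_set_iff_inv_smul_mem]
    have h1 : (ofFun Q φ).1 (q⁻¹ • y) y := ofFun_rel.2 ⟨q⁻¹, inv_mem hq, rfl⟩
    exact ⟨fun h => Setoid.trans' _ (Setoid.symm' _ h1) h, fun h => Setoid.trans' _ h1 h⟩

theorem mem_blocks [Finite X] {P : OrbitPartition Q X} {B : Set X} :
    B ∈ P.blocks ↔ B ∈ P.1.classes :=
  Set.Finite.mem_toFinset _

theorem ncard_pos_of_mem_blocks [Finite X] {P : OrbitPartition Q X} {B : Set X}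
    (h : B ∈ P.blocks) : 0 < B.ncard := by
  rw [Set.ncard_pos]
  exact Setoid.nonempty_of_mem_partition P.1.isPartition_classes (mem_blocks.1 h)

theorem prod_blocks [Finite X] {M : Type*} [CommMonoid M] (P : OrbitPartition Q X)
    [Fintype (Quotient P.1)] (F : Set X → M) :
    ∏ B ∈ P.blocks, F B = ∏ c : Quotient P.1, F {x | (Quotient.mk P.1 x) = c} := by
  symm
  refine Finset.prod_bij (fun c _ => {x | (Quotient.mk P.1 x) = c}) ?_ ?_ ?_ ?_
  · intro c _
    rw [mem_blocks]
    induction c using Quotient.inductionOn with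
    | h y => exact ⟨y, Set.ext fun x => Quotient.eq⟩
  · intro c _ c' _ h
    induction c using Quotient.inductionOn with
    | h y => exact (h ▸ (rfl : y ∈ {x | Quotient.mk P.1 x = Quotient.mk P.1 y}) :
        y ∈ {x | Quotient.mk P.1 x = c'})
  · intro B hB
    obtain ⟨y, rfl⟩ := mem_blocks.1 hB
    exact ⟨Quotient.mk P.1 y, Finset.mem_univ _, Set.ext fun x => Quotient.eq⟩
  · intro c _
    rfl

open ArithmeticFunction in
-- Expanding the product chooses an index for each block, which amounts to a function constant on
-- blocks. A block `B` with value `i` contributes `d i ^ |B|`.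
theorem prod_blocks_dilate [Fintype X] [DecidableEq X] [Fintype ι] (P : OrbitPartition Q X)
    (d : ι → ℕ) (hd : ∀ i, d i ≠ 0) :
    ∏ B ∈ P.blocks, dirichletDilate B.ncard (∑ i, dirac (d i)) =
      ∑ φ : X → ι with P ≤ ofFun Q φ, dirac (∏ x, d (φ x)) := by
  classical
  have h1 : ∀ B ∈ P.blocks, dirichletDilate B.ncard (∑ i, dirac (d i)) =
      ∑ i, dirac (d i ^ B.ncard) := by
    intro B hB
    rw [dirichletDilate_sum]
    exact Finset.sum_congr rfl fun i _ =>
      dirichletDilate_dirac (ncard_pos_of_mem_blocks hB).ne' (hd i)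
  rw [Finset.prod_congr rfl h1, prod_blocks, Finset.prod_univ_sum]
  refine Finset.sum_bij (fun g _ x => g (Quotient.mk P.1 x)) ?_ ?_ ?_ ?_
  · intro g _
    rw [Finset.mem_filter, le_ofFun_iff]
    refine ⟨Finset.mem_univ _, fun x y hxy => ?_⟩
    exact congrArg g (Quotient.sound hxy)
  · intro g _ g' _ h
    funext c
    induction c using Quotient.inductionOn with
    | h y => exact congrFun h y
  · intro φ hφ
    rw [Finset.mem_filter, le_ofFun_iff] at hφ
    exact ⟨Quotient.lift φ fun x y h => hφ.2 h, by simp, rfl⟩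
  · intro g _
    rw [prod_dirac _ _ fun c _ => pow_ne_zero _ (hd _)]
    congr 1
    rw [← Finset.prod_fiberwise (s := Finset.univ) (g := Quotient.mk P.1)]
    refine Finset.prod_congr rfl fun c _ => ?_
    rw [Finset.prod_congr rfl (g := fun _ => d (g c)), Finset.prod_const,
      Set.ncard_eq_toFinset_card', Set.toFinset_ofPred]
    intro x hx
    exact congrArg (fun c => d (g c)) (Finset.mem_filter.1 hx).2

open ArithmeticFunction in
/-- Möbius inversion. -/
theorem sum_mobius [Fintype X] [DecidableEq X] [Fintype ι] (P : OrbitPartition Q X)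
    (F : (X → ι) → ArithmeticFunction ℂ) :
    ∑ P' : OrbitPartition Q X with P ≤ P', P.mobius P' •
        ∑ φ : X → ι with P' ≤ ofFun Q φ, F φ =
      ∑ φ : X → ι with P = ofFun Q φ, F φ := by
  -- After exchanging sums, the coefficient of `F φ` is the sum of `μ(P, ·)` over the interval from
  -- `P` to `ofFun Q φ`.
  have h : ∀ φ : X → ι, (∑ P' : OrbitPartition Q X with P ≤ P',
      if P' ≤ ofFun Q φ then P.mobius P' else 0) = if P = ofFun Q φ then 1 else 0 := by
    intro φ
    rw [← IncidenceAlgebra.sum_Icc_mu_right (𝕜 := ℤ) P (ofFun Q φ), ← Finset.sum_filter]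
    refine Finset.sum_congr ?_ fun _ _ => rfl
    ext P'
    simp
  calc _ = ∑ P' : OrbitPartition Q X with P ≤ P', ∑ φ : X → ι,
        (if P' ≤ ofFun Q φ then P.mobius P' else 0) • F φ := by
        refine Finset.sum_congr rfl fun P' _ => ?_
        rw [Finset.sum_filter, zsmul_eq_mul, Finset.mul_sum]
        refine Finset.sum_congr rfl fun φ _ => ?_
        rw [zsmul_eq_mul]
        split_ifs <;> simp
    _ = ∑ φ : X → ι, (if P = ofFun Q φ then (1 : ℤ) else 0) • F φ := by
        rw [Finset.sum_comm]
        refine Finset.sum_congr rfl fun φ _ => ?_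
        rw [← h φ, zsmul_eq_mul, Int.cast_sum, Finset.sum_mul]
        simp only [zsmul_eq_mul]
    _ = _ := by
        rw [Finset.sum_filter]
        refine Finset.sum_congr rfl fun φ _ => ?_
        split_ifs <;> simp

end OrbitPartition

end

noncomputable section

set_option linter.unusedSectionVars false

open Module Representation ArithmeticFunction

/-! ### The zeta series of a wreath product -/

namespace PermWreath

variable {H Q X : Type*} [Group H] [TopologicalSpace H] [Group Q] [TopologicalSpace Q]
  [MulAction Q X] [Fintype X] [dX : DecidableEq X] [Finite Q] [DiscreteTopology Q]
  {ι : Type*} [Fintype ι] {d : ι → ℕ} {W : ∀ i, ContIrrep H (d i)}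
  (S : PrimitiveSystem (familyHom W) d)

/-- Group the functions `φ` by `ofFun Q φ`. Agreement up to `n` lets a finite family of
representations stand in for the whole dual of `H`, since all operations involved respect
truncation. -/
theorem sum_orbitPartition_agreeUpTo {f : ArithmeticFunction ℂ} {n : ℕ} (hd : ∀ i, d i ≠ 0)
    (hf : AgreeUpTo n f (∑ i, dirac (d i))) (F : Subgroup Q → ArithmeticFunction ℂ) :
    AgreeUpTo n (∑ P : OrbitPartition Q X, F P.stab *
        ∑ P' : OrbitPartition Q X with P ≤ P',
          P.mobius P' • ∏ B ∈ P'.blocks, dirichletDilate B.ncard f)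
      (∑ φ : X → ι, F (fixer Q φ) * dirac (∏ x, d (φ x))) := by
  have h : ∑ φ : X → ι, F (fixer Q φ) * dirac (∏ x, d (φ x)) =
      ∑ P : OrbitPartition Q X, F P.stab *
        ∑ P' : OrbitPartition Q X with P ≤ P',
          P.mobius P' • ∏ B ∈ P'.blocks, dirichletDilate B.ncard (∑ i, dirac (d i)) := by
    rw [← Finset.sum_fiberwise (s := Finset.univ) (g := fun φ : X → ι => OrbitPartition.ofFun Q φ)]
    refine Finset.sum_congr rfl fun P _ => ?_
    simp only [OrbitPartition.prod_blocks_dilate _ d hd, OrbitPartition.sum_mobius]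
    rw [Finset.mul_sum]
    refine Finset.sum_congr (Finset.filter_congr fun φ _ => eq_comm) fun φ hφ => ?_
    rw [(Finset.mem_filter.1 hφ).2, OrbitPartition.stab_ofFun]
  rw [h]
  exact AgreeUpTo.sum fun P _ => AgreeUpTo.mul (fun _ _ => rfl) <|
    AgreeUpTo.sum fun P' _ => (AgreeUpTo.prod fun B _ => hf.dilate _).zsmul _

theorem coeff_eq_natCard_contains {n : ℕ} (hn : n ≠ 0) (hd : ∀ i, d i ≠ 0) (φ : X → ι) :
    (dirichletPow (fixer Q φ).index * repZetaSeries (fixer Q φ) * dirac (∏ x, d (φ x))) n =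
      ((fixer Q φ).index : ℂ)⁻¹ *
        Nat.card {c : IrrDual (PermWreath H Q X) n // Contains S φ c} := by
  have h1 : ∏ x, d (φ x) ≠ 0 := Finset.prod_ne_zero_iff.2 fun x _ => hd _
  have h2 := (index_fixer_pos (Q := Q) φ).ne'
  have h3 : dirichletPow (fixer Q φ).index * repZetaSeries (fixer Q φ) * dirac (∏ x, d (φ x)) =
      ((fixer Q φ).index : ℂ)⁻¹ •
        (repZetaSeries (fixer Q φ) * dirac ((fixer Q φ).index * ∏ x, d (φ x))) := by
    rw [dirichletPow_eq, ← dirac_mul_dirac h2 h1]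
    ext k
    simp only [smul_mul_assoc]
    rw [mul_comm (dirac (fixer Q φ).index), mul_assoc]
  rw [h3]
  change ((fixer Q φ).index : ℂ)⁻¹ * (repZetaSeries (fixer Q φ) *
    dirac ((fixer Q φ).index * ∏ x, d (φ x))) n = _
  congr 1
  by_cases h : (fixer Q φ).index * (∏ x, d (φ x)) ∣ n
  · obtain ⟨m, rfl⟩ := h
    rw [natCard_contains, mul_dirac_apply_mul _ (mul_ne_zero h2 h1), repZetaSeries_apply]
  · rw [natCard_contains_eq_zero S h, mul_dirac_apply_of_not_dvd _ (mul_ne_zero h2 h1) h,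
      Nat.cast_zero]

theorem repZetaSeries_coeff_eq (S : PrimitiveSystem (familyHom W) d) {n : ℕ} (hn : n ≠ 0) (hd : ∀ i, d i ≠ 0)
    (hH : AgreeUpTo n (repZetaSeries H) (∑ i, dirac (d i)))
    (h : ∀ c : IrrDual (PermWreath H Q X) n, IsType (familyHom W) c.out.rep) :
    repZetaSeries (PermWreath H Q X) n =
      (∑ P : OrbitPartition Q X, dirichletPow P.stab.index * repZetaSeries P.stab *
        ∑ P' : OrbitPartition Q X with P ≤ P',
          P.mobius P' • ∏ B ∈ P'.blocks, dirichletDilate B.ncard (repZetaSeries H)) n := by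
  rw [sum_orbitPartition_agreeUpTo hd hH (fun T => dirichletPow T.index * repZetaSeries T) n le_rfl,
    finset_sum_apply, repZetaSeries_apply, natCard_irrDual_eq_sum S h]
  exact Finset.sum_congr rfl fun φ _ => (coeff_eq_natCard_contains S hn hd φ).symm

end PermWreath

/-! ### Truncation of the dual by degree -/

section Dual

variable {G : Type*} [Group G] [TopologicalSpace G]

theorem IsRigid.finite_irrDual (h : IsRigid G) (n : ℕ) : Finite (IrrDual G n) := by
  rcases Nat.eq_zero_or_pos n with rfl | hn
  · have := isEmpty_irrDual_zero (G := G)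
    infer_instance
  · exact numIrreps_lt_top_iff.1 (h n hn)

theorem IsRigid.finite_degree_le (h : IsRigid G) (n : ℕ) :
    Finite {i : Σ m, IrrDual G m // i.1 ≤ n} := by
  have := fun m : Fin (n + 1) => h.finite_irrDual m
  refine Finite.of_injective
    (fun i => (⟨⟨i.1.1, Nat.lt_succ_of_le i.2⟩, i.1.2⟩ : Σ m : Fin (n + 1), IrrDual G m)) ?_
  rintro ⟨⟨m, c⟩, hm⟩ ⟨⟨m', c'⟩, hm'⟩ he
  simp only [Sigma.mk.injEq, Fin.mk.injEq] at he
  obtain ⟨rfl, he⟩ := he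
  obtain rfl := eq_of_heq he
  rfl

theorem repZetaSeries_agreeUpTo (n : ℕ) [Fintype {i : Σ m, IrrDual G m // i.1 ≤ n}] :
    AgreeUpTo n (repZetaSeries G)
      (∑ i : {i : Σ m, IrrDual G m // i.1 ≤ n}, dirac i.1.1) := by
  classical
  intro k hk
  have hpos : ∀ i : {i : Σ m, IrrDual G m // i.1 ≤ n}, i.1.1 ≠ 0 := fun i => i.1.2.out.pos.ne'
  rw [finset_sum_apply, repZetaSeries_apply]
  simp only [dirac_apply (hpos _)]
  rw [Finset.sum_boole, ← Fintype.card_subtype, ← Nat.card_eq_fintype_card]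
  congr 1
  refine Nat.card_congr
    { toFun := fun c => ⟨⟨⟨k, c⟩, hk⟩, rfl⟩
      invFun := fun i => cast (congrArg (IrrDual G) i.2.symm) i.1.1.2
      left_inv := fun c => rfl
      right_inv := ?_ }
  rintro ⟨⟨⟨m, c⟩, hm⟩, hk'⟩
  obtain rfl : k = m := hk'
  rfl

end Dual

/-! ### The formal identity and rigidity -/

namespace PermWreath

variable {H Q X : Type*} [Group H] [TopologicalSpace H] [Group Q] [TopologicalSpace Q]
  [MulAction Q X] [Finite Q] [DiscreteTopology Q]

theorem isType_degree_le [Fintype X] [DecidableEq X] {n : ℕ} (c : IrrDual (PermWreath H Q X) n) :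
    IsType (familyHom fun i : {i : Σ m, IrrDual H m // i.1 ≤ n} => i.1.2.out) c.out.rep := by
  refine isType_of_forall_exists_equiv _ c.out.irreducible c.out.matrixContinuous _ ?_
  intro m hm c'
  exact ⟨⟨⟨m, ⟦c'⟧⟩, by simpa using hm⟩, equiv_out c'⟩

theorem finite_irrDual_of_isRigid [Finite X] (h : IsRigid H) (n : ℕ) :
    Finite (IrrDual (PermWreath H Q X) n) := by
  classical
  have := Fintype.ofFinite X
  have := h.finite_degree_le n
  have := Fintype.ofFinite {i : Σ m, IrrDual H m // i.1 ≤ n}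
  obtain ⟨S⟩ := (pairwiseInequivalent_out (G := H)
    (f := fun i : {i : Σ m, IrrDual H m // i.1 ≤ n} => i.1)
    Subtype.val_injective).nonempty_primitiveSystem
  exact finite_irrDual_of_forall_isType S isType_degree_le

theorem repZetaSeries_eq [Finite X] (h : IsRigid H) :
    repZetaSeries (PermWreath H Q X) =
      ∑ P : OrbitPartition Q X, dirichletPow P.stab.index * repZetaSeries P.stab *
        ∑ P' : OrbitPartition Q X with P ≤ P',
          P.mobius P' • ∏ B ∈ P'.blocks, dirichletDilate B.ncard (repZetaSeries H) := by
  classical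
  ext n
  rcases eq_or_ne n 0 with rfl | hn
  · rw [ArithmeticFunction.map_zero, ArithmeticFunction.map_zero]
  have := Fintype.ofFinite X
  have := h.finite_degree_le n
  have := Fintype.ofFinite {i : Σ m, IrrDual H m // i.1 ≤ n}
  obtain ⟨S⟩ := (pairwiseInequivalent_out (G := H)
    (f := fun i : {i : Σ m, IrrDual H m // i.1 ≤ n} => i.1)
    Subtype.val_injective).nonempty_primitiveSystem
  exact repZetaSeries_coeff_eq S hn (fun i => i.1.2.out.pos.ne') (repZetaSeries_agreeUpTo n) isType_degree_le

/-- Irreducible representations of the wreath product lying over functions with a single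
nontrivial value. -/
theorem card_le_sum [Finite X] [Nonempty X] (hG : ∀ m, Finite (IrrDual (PermWreath H Q X) m)) {n : ℕ}
    (s : Finset (IrrDual H n)) :
    s.card ≤ ∑ k ∈ Finset.Icc 1 (Nat.card Q),
      Nat.card Q * Nat.card (IrrDual (PermWreath H Q X) (k * n)) := by
  classical
  have := Fintype.ofFinite X
  obtain ⟨x₀⟩ := ‹Nonempty X›
  -- The family is finite even if `H` is not rigid. The trivial class serves as the value away from
  -- `x₀`, which makes the product of the degrees equal to `n`.
  let t : Finset (Σ m, IrrDual H m) :=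
    insert ⟨1, ⟦ContIrrep.trivial H⟧⟩ (s.map ⟨Sigma.mk n, sigma_mk_injective⟩)
  let triv : t := ⟨⟨1, ⟦ContIrrep.trivial H⟧⟩, Finset.mem_insert_self _ _⟩
  obtain ⟨S⟩ := (pairwiseInequivalent_out (G := H) (f := fun i : t => i.1)
    Subtype.val_injective).nonempty_primitiveSystem
  let φ : s → X → t := fun c => Function.update (fun _ => triv) x₀
    ⟨⟨n, c.1⟩, Finset.mem_insert_of_mem (Finset.mem_map_of_mem _ c.2)⟩
  have hφ : Function.Injective φ := by
    intro c c' h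
    have h1 := congrArg Subtype.val (congrFun h x₀)
    simp only [φ, Function.update_self] at h1
    exact Subtype.ext (sigma_mk_injective h1)
  have hprod : ∀ c, ∏ x, (φ c x).1.1 = n := by
    intro c
    rw [Finset.prod_eq_single x₀]
    · simp [φ]
    · intro x _ hx
      simp [φ, hx, triv]
    · simp
  calc s.card = ∑ k ∈ Finset.Icc 1 (Nat.card Q),
        {c ∈ s.attach | (fixer Q (φ c)).index = k}.card := by
        rw [← Finset.card_attach]
        refine Finset.card_eq_sum_card_fiberwise fun c _ => ?_
        rw [Finset.mem_coe, Finset.mem_Icc]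
        exact ⟨index_fixer_pos _, Nat.le_of_dvd Nat.card_pos (Subgroup.index_dvd_card _)⟩
    _ ≤ _ := by
        refine Finset.sum_le_sum fun k _ => ?_
        have := hG (k * n)
        refine le_trans ?_ (card_filter_le (Q := Q) (n := k * n) S)
        refine Finset.card_le_card_of_injOn φ (fun c hc => ?_) hφ.injOn
        rw [Finset.mem_coe, Finset.mem_filter]
        refine ⟨Finset.mem_univ _, ?_⟩
        rw [hprod, (Finset.mem_filter.1 hc).2]

theorem isRigid_iff [Finite X] [Nonempty X] : IsRigid (PermWreath H Q X) ↔ IsRigid H := by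
  refine ⟨fun h n _ => numIrreps_lt_top_iff.2 ?_,
    fun h n _ => numIrreps_lt_top_iff.2 (finite_irrDual_of_isRigid h n)⟩
  by_contra hinf
  rw [not_finite_iff_infinite] at hinf
  obtain ⟨s, hs⟩ := Infinite.exists_subset_card_eq (IrrDual H n)
    ((∑ k ∈ Finset.Icc 1 (Nat.card Q),
      Nat.card Q * Nat.card (IrrDual (PermWreath H Q X) (k * n))) + 1)
  have := card_le_sum (Q := Q) (X := X) (fun m => h.finite_irrDual m) s
  omega

theorem natCard_irrDual_le [Finite X] [Nonempty X] (h : IsRigid H) (n : ℕ) :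
    Nat.card (IrrDual H n) ≤ ∑ k ∈ Finset.Icc 1 (Nat.card Q),
      Nat.card Q * Nat.card (IrrDual (PermWreath H Q X) (k * n)) := by
  have := h.finite_irrDual n
  have := Fintype.ofFinite (IrrDual H n)
  rw [Nat.card_eq_fintype_card]
  exact card_le_sum (fun m => (isRigid_iff.2 h).finite_irrDual m) Finset.univ

end PermWreath

end

noncomputable section

set_option linter.unusedSectionVars false

open Module Representation ArithmeticFunction

/-! ### Convergence -/

namespace ArithmeticFunction

theorem intSMul_apply (c : ℤ) (f : ArithmeticFunction ℂ) (n : ℕ) : (c • f) n = c * f n := by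
  let e : ArithmeticFunction ℂ →+ ℂ := ⟨⟨fun f => f n, rfl⟩, fun _ _ => rfl⟩
  exact (map_zsmul e c f).trans (zsmul_eq_mul _ _)

theorem LSeriesHasSum_zsmul (c : ℤ) {f : ArithmeticFunction ℂ} {s a : ℂ}
    (h : LSeriesHasSum f s a) : LSeriesHasSum (c • f : ArithmeticFunction ℂ) s (c * a) := by
  refine (LSeriesHasSum_congr s _ fun {n} _ => ?_).1 (h.smul (c : ℂ))
  exact (intSMul_apply c f n).symm

theorem LSeriesHasSum_finsetSum {α : Type*} {t : Finset α} {f : α → ArithmeticFunction ℂ}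
    {s : ℂ} {a : α → ℂ} (h : ∀ i ∈ t, LSeriesHasSum (f i) s (a i)) :
    LSeriesHasSum (∑ i ∈ t, f i : ArithmeticFunction ℂ) s (∑ i ∈ t, a i) := by
  refine (LSeriesHasSum_congr s _ fun {n} _ => ?_).1 (LSeriesHasSum.sum h)
  rw [finset_sum_apply, Finset.sum_apply]

theorem LSeriesHasSum_dirac (m : ℕ) (hm : m ≠ 0) (s : ℂ) :
    LSeriesHasSum (dirac m) s ((m : ℂ) ^ (-s)) := by
  have h : (m : ℂ) ^ (-s) = LSeries.term (dirac m) s m := by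
    rw [LSeries.term_of_ne_zero hm, dirac_apply hm, if_pos rfl, Complex.cpow_neg, one_div]
  rw [h]
  refine hasSum_single m fun n hn => ?_
  rcases eq_or_ne n 0 with rfl | h0
  · exact LSeries.term_zero _ _
  · rw [LSeries.term_of_ne_zero h0, dirac_apply hm, if_neg hn, zero_div]

theorem LSeriesHasSum_finsetProd {α : Type*} {t : Finset α} {f : α → ArithmeticFunction ℂ}
    {s : ℂ} {a : α → ℂ} (h : ∀ i ∈ t, LSeriesHasSum (f i) s (a i)) :
    LSeriesHasSum (∏ i ∈ t, f i : ArithmeticFunction ℂ) s (∏ i ∈ t, a i) := by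
  classical
  induction t using Finset.induction_on with
  | empty =>
    rw [Finset.prod_empty, Finset.prod_empty, ← dirac_one]
    simpa using LSeriesHasSum_dirac 1 one_ne_zero s
  | insert i t hi ih =>
    rw [Finset.prod_insert hi, Finset.prod_insert hi]
    exact LSeriesHasSum_mul (h i (Finset.mem_insert_self i t))
      (ih fun j hj => h j (Finset.mem_insert_of_mem hj))

theorem LSeriesHasSum_dirichletPow {m : ℕ} (hm : m ≠ 0) (s : ℂ) :
    LSeriesHasSum (dirichletPow m) s ((m : ℂ) ^ (-1 - s)) := by
  have hm' : (m : ℂ) ≠ 0 := Nat.cast_ne_zero.2 hm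
  rw [dirichletPow_eq, sub_eq_add_neg, Complex.cpow_add _ _ hm', Complex.cpow_neg_one]
  exact (LSeriesHasSum_congr s _ fun {n} _ => rfl).1
    ((LSeriesHasSum_dirac m hm s).smul ((m : ℂ)⁻¹))

theorem dirichletDilate_apply_pow {k d : ℕ} (hk : k ≠ 0) (hd : d ≠ 0) (f : ArithmeticFunction ℂ) :
    dirichletDilate k f (d ^ k) = f d := by
  rw [dirichletDilate_apply, Finset.sum_eq_single_of_mem d]
  · exact Finset.mem_filter.2
      ⟨Nat.mem_divisors.2 ⟨dvd_pow_self d hk, pow_ne_zero k hd⟩, rfl⟩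
  · intro d' hd' hne
    exact absurd (Nat.pow_left_injective hk (Finset.mem_filter.1 hd').2) hne

/-- The dilated series is supported on `k`-th powers, and `(d^k)^(-s) = d^(-ks)` reindexes it. -/
theorem LSeriesHasSum_dirichletDilate {k : ℕ} (hk : k ≠ 0) {f : ArithmeticFunction ℂ} {s a : ℂ}
    (h : LSeriesHasSum f (k * s) a) : LSeriesHasSum (dirichletDilate k f) s a := by
  refine ((Nat.pow_left_injective hk).hasSum_iff ?_).1 (HasSum.congr_fun h ?_)
  · intro n hn
    rcases eq_or_ne n 0 with rfl | h0
    · exact LSeries.term_zero _ _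
    · rw [LSeries.term_of_ne_zero h0, dirichletDilate_apply, Finset.sum_eq_zero, zero_div]
      intro d hd
      exact absurd ⟨d, (Finset.mem_filter.1 hd).2⟩ hn
  · intro d
    rcases eq_or_ne d 0 with rfl | hd
    · simp [zero_pow hk]
    · rw [Function.comp_apply, LSeries.term_of_ne_zero hd,
        LSeries.term_of_ne_zero (pow_ne_zero k hd), dirichletDilate_apply_pow hk hd,
        Complex.natCast_cpow_natCast_mul, Nat.cast_pow]

theorem LSeriesSummable_of_finite_support {f : ArithmeticFunction ℂ}
    (h : {n | f n ≠ 0}.Finite) (s : ℂ) : LSeriesSummable f s := by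
  refine summable_of_hasFiniteSupport (h.subset fun n hn h0 => hn ?_)
  rcases eq_or_ne n 0 with rfl | hn0
  · exact LSeries.term_zero _ _
  · rw [LSeries.term_of_ne_zero hn0, h0, zero_div]

/-- A Dirichlet series without small nonzero coefficients that converges absolutely at `s`
also converges absolutely at `k s`. -/
theorem LSeriesSummable_natCast_mul {f : ArithmeticFunction ℂ} (hf : ∀ n, f n ≠ 0 → 1 ≤ ‖f n‖)
    {s : ℂ} (h : LSeriesSummable f s) {k : ℕ} (hk : k ≠ 0) : LSeriesSummable f (k * s) := by
  have hk' : (1 : ℝ) ≤ k := Nat.one_le_cast.2 (Nat.one_le_iff_ne_zero.2 hk)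
  rcases le_total 0 s.re with hs | hs
  · refine h.of_re_le_re ?_
    simpa using le_mul_of_one_le_left hs hk'
  -- For `re s ≤ 0` every nonzero term has norm at least one, so summability leaves finitely many
  -- nonzero coefficients.
  · refine LSeriesSummable_of_finite_support ?_ _
    have h1 := (tendsto_zero_iff_norm_tendsto_zero.1 h.tendsto_cofinite_zero).eventually
      (gt_mem_nhds one_pos)
    refine Set.Finite.subset h1 fun n hn hlt => ?_
    have hn0 : n ≠ 0 := by
      rintro rfl
      exact hn f.map_zero
    have h2 : ‖f n‖ ≤ ‖LSeries.term f s n‖ := by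
      rw [LSeries.norm_term_eq, if_neg hn0]
      rw [le_div_iff₀ (Real.rpow_pos_of_pos (Nat.cast_pos.2 (Nat.pos_of_ne_zero hn0)) _)]
      refine mul_le_of_le_one_right (norm_nonneg _) ?_
      exact Real.rpow_le_one_of_one_le_of_nonpos
        (Nat.one_le_cast.2 (Nat.one_le_iff_ne_zero.2 hn0)) hs
    exact absurd (lt_of_le_of_lt ((hf n hn).trans h2) hlt) (lt_irrefl _)

end ArithmeticFunction

section Dual

variable {G : Type*} [Group G] [TopologicalSpace G]

theorem one_le_norm_repZetaSeries (n : ℕ) (h : repZetaSeries G n ≠ 0) :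
    1 ≤ ‖repZetaSeries G n‖ := by
  rw [repZetaSeries_apply] at h ⊢
  rw [Complex.norm_natCast, Nat.one_le_cast]
  exact Nat.one_le_iff_ne_zero.2 (Nat.cast_ne_zero.1 h)

theorem repZetaConverges_of_finite [Finite G] (s : ℂ) : RepZetaConverges G s := by
  have := finite_sigma_irrDual (G := G)
  refine LSeriesSummable_of_finite_support
    ((Set.finite_range (Sigma.fst : (Σ n, IrrDual G n) → ℕ)).subset fun n hn => ?_) s
  rw [Set.mem_ofPred_eq, repZetaSeries_apply, Nat.cast_ne_zero] at hn
  obtain ⟨c⟩ := (Nat.card_ne_zero.1 hn).1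
  exact ⟨⟨n, c⟩, rfl⟩

theorem RepZetaConverges.hasSum {s : ℂ} (h : RepZetaConverges G s) :
    LSeriesHasSum (repZetaSeries G) s (repZeta G s) :=
  LSeriesSummable.LSeriesHasSum h

theorem RepZetaConverges.natCast_mul {s : ℂ} (h : RepZetaConverges G s) {k : ℕ} (hk : k ≠ 0) :
    RepZetaConverges G (k * s) :=
  LSeriesSummable_natCast_mul one_le_norm_repZetaSeries h hk

end Dual

namespace PermWreath

variable {H Q X : Type*} [Group H] [TopologicalSpace H] [Group Q] [TopologicalSpace Q]
  [MulAction Q X] [Finite X] [Finite Q] [DiscreteTopology Q]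

theorem hasSum_repZeta (h : IsRigid H) {s : ℂ} (hs : RepZetaConverges H s) :
    LSeriesHasSum (repZetaSeries (PermWreath H Q X)) s
      (∑ P : OrbitPartition Q X, (P.stab.index : ℂ) ^ (-1 - s) * repZeta P.stab s *
        ∑ P' : OrbitPartition Q X with P ≤ P',
          (P.mobius P' : ℂ) * ∏ B ∈ P'.blocks, repZeta H ((B.ncard : ℂ) * s)) := by
  rw [repZetaSeries_eq h]
  refine LSeriesHasSum_finsetSum fun P _ => LSeriesHasSum_mul (LSeriesHasSum_mul ?_ ?_) ?_
  · exact LSeriesHasSum_dirichletPow Subgroup.FiniteIndex.index_ne_zero s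
  · exact (repZetaConverges_of_finite s).hasSum
  · refine LSeriesHasSum_finsetSum fun P' _ => LSeriesHasSum_zsmul _ ?_
    refine LSeriesHasSum_finsetProd fun B hB => ?_
    have hB' := (OrbitPartition.ncard_pos_of_mem_blocks hB).ne'
    exact LSeriesHasSum_dirichletDilate hB' (hs.natCast_mul hB').hasSum

/-- The bound on `r_n(H)` divided by `n^(re s)`; the factor `k^(re s)` compensates for passing to
the term of index `k * n`. It transfers absolute convergence from the wreath product to `H`. -/
theorem norm_term_le_sum [Nonempty X] (h : IsRigid H) (s : ℂ) (n : ℕ) :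
    ‖LSeries.term (repZetaSeries H) s n‖ ≤ ∑ k ∈ Finset.Icc 1 (Nat.card Q),
      Nat.card Q * (k : ℝ) ^ s.re *
        ‖LSeries.term (repZetaSeries (PermWreath H Q X)) s (k * n)‖ := by
  rcases eq_or_ne n 0 with rfl | hn
  · simp
  have hn' : (0 : ℝ) < (n : ℝ) ^ s.re :=
    Real.rpow_pos_of_pos (Nat.cast_pos.2 (Nat.pos_of_ne_zero hn)) _
  rw [LSeries.norm_term_eq, if_neg hn, div_le_iff₀ hn', Finset.sum_mul, repZetaSeries_apply,
    Complex.norm_natCast]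
  refine (Nat.cast_le.2 (natCard_irrDual_le (Q := Q) (X := X) h n)).trans_eq ?_
  rw [Nat.cast_sum]
  refine Finset.sum_congr rfl fun k hk => ?_
  have hk0 : k ≠ 0 := Nat.one_le_iff_ne_zero.1 (Finset.mem_Icc.1 hk).1
  have hk' : (0 : ℝ) < (k : ℝ) ^ s.re :=
    Real.rpow_pos_of_pos (Nat.cast_pos.2 (Nat.pos_of_ne_zero hk0)) _
  rw [LSeries.norm_term_eq, if_neg (mul_ne_zero hk0 hn), repZetaSeries_apply,
    Complex.norm_natCast, Nat.cast_mul, Nat.cast_mul,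
    Real.mul_rpow (Nat.cast_nonneg k) (Nat.cast_nonneg n)]
  field_simp

theorem repZetaConverges_iff [Nonempty X] (h : IsRigid H) (s : ℂ) :
    RepZetaConverges (PermWreath H Q X) s ↔ RepZetaConverges H s := by
  refine ⟨fun hs => ?_, fun hs => (hasSum_repZeta h hs).LSeriesSummable⟩
  refine Summable.of_norm (Summable.of_nonneg_of_le (fun _ => norm_nonneg _)
    (norm_term_le_sum (Q := Q) (X := X) h s) (summable_sum fun k hk => Summable.mul_left _ ?_))
  have hk0 : 0 < k := (Finset.mem_Icc.1 hk).1
  exact (Summable.norm hs).comp_injective (mul_right_injective₀ hk0.ne')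

end PermWreath

end

theorem theorem1
    (H : Type*) [Group H] [TopologicalSpace H] [IsTopologicalGroup H]
    (Q : Type*) [Group Q] [Finite Q] [TopologicalSpace Q] [DiscreteTopology Q]
    (X : Type*) [Finite X] [Nonempty X] [MulAction Q X] :
    (IsRigid (PermWreath H Q X) ↔ IsRigid H) ∧
    (IsRigid H →
      -- the identity of formal Dirichlet series
      (repZetaSeries (PermWreath H Q X) =
        ∑ P : OrbitPartition Q X,
          dirichletPow P.stab.index * repZetaSeries P.stab *
            ∑ P' : OrbitPartition Q X with P ≤ P',
              P.mobius P' • ∏ B ∈ P'.blocks, dirichletDilate B.ncard (repZetaSeries H)) ∧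
      -- the identity of functions, wherever one of the two zeta series converges absolutely
      (∀ s : ℂ, (RepZetaConverges (PermWreath H Q X) s ↔ RepZetaConverges H s) ∧
        (RepZetaConverges H s →
          repZeta (PermWreath H Q X) s =
            ∑ P : OrbitPartition Q X,
              (P.stab.index : ℂ) ^ (-1 - s) * repZeta P.stab s *
                ∑ P' : OrbitPartition Q X with P ≤ P',
                  (P.mobius P' : ℂ) * ∏ B ∈ P'.blocks, repZeta H ((B.ncard : ℂ) * s)))) :=
  ⟨PermWreath.isRigid_iff, fun h => ⟨PermWreath.repZetaSeries_eq h, fun s =>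
    ⟨PermWreath.repZetaConverges_iff h s, fun hs =>
      (PermWreath.hasSum_repZeta h hs).LSeries_eq⟩⟩⟩
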